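/- Let $n_1,n_2,n_3,M\ge 1$ be integers, $T>0$, $a_i<b_i$, $\delta_i\in(0,1)$ and $k_{i,+},k_{i,-}>0$ ($i=1,2,3$). Put $N=n_1n_2n_3$, $\Delta t=T/M$, $h_i=(b_i-a_i)/(n_i+1)$ and $\eta_i=\dfrac{\Delta t}{2\Gamma(\delta_i+1)h_i^{2-\delta_i}}$. For $\delta\in(0,1)$ let $s_0^{(\delta)}=(\tfrac12)^\delta$, $s_1^{(\delta)}=(\tfrac32)^\delta-2(\tfrac12)^\delta$, $s_k^{(\delta)}=(k+\tfrac12)^\delta-2(k-\tfrac12)^\delta+(k-\tfrac32)^\delta$ for $k\ge2$, and $q_0^{(\delta)}=-s_0^{(\delta)}$, $q_k^{(\delta)}=s_{k-1}^{(\delta)}-s_k^{(\delta)}$ for $k\ge1$. Let $\mathbf T_n^{\delta}\in\mathbb R^{n\times n}$ be the Toeplitz matrix with $(i,j)$ entry $q_{i-j+1}^{(\delta)}$ if $j\le i+1$ and $0$ otherwise, let $\mathbf A_n=\frac18\operatorname{tridiag}(1,6,1)\in\mathbb R^{n\times n}$, and let $\mathbf B_i=k_{i,+}\mathbf T_{n_i}^{\delta_i}+k_{i,-}(\mathbf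 T_{n_i}^{\delta_i})^{\top}$. Write $\mathcal H(\mathbf Z)=(\mathbf Z+\mathbf Z^\top)/2$, and for a symmetric Toeplitz matrix $\mathbf C=[t_{|i-j|}]_{i,j=1}^n$ let $\tau(\mathbf C)=\big[t_{|i-j|}-t_{i+j}-t_{2(n+1)-(i+j)}\big]_{i,j=1}^n$, where $t_l:=0$ for $l\ge n$ (the $\tau$ matrix of $\mathbf C$, which is diagonalized by the discrete sine transform). Define $$\mathbf A=\mathbf A_{n_3}\otimes\mathbf A_{n_2}\otimes\mathbf A_{n_1}+\eta_1\mathbf A_{n_3}\otimes\mathbf A_{n_2}\otimes\mathbf B_1+\eta_2\mathbf A_{n_3}\otimes\mathbf B_2\otimes\mathbf A_{n_1}+\eta_3\mathbf B_3\otimes\mathbf A_{n_2}\otimes\mathbf A_{n_1},$$ and let $\mathbf P$ be the matrix obtained from the same formula by replacing each $\mathbf B_i$ by $\tau(\mathcal H(\mathbf B_i))$. These are the coefficient matrix of the Crank–Nicolson finite volume scheme for a three-dimensional conservative space-fractional diffusion equation and its sine-transform based preconditioner. Then $\mathbf P$ is symmetric positive definite (so $\mathbf P^{-1/2}$ is defined),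 and for every $\mathbf b\in\mathbb R^N$ and every initial guess $\mathbf v_0\in\mathbb R^N$, the iterates $\mathbf v_k$ of GMRES, either non-restarted or restarted after every $m$ steps for any $m\ge1$, applied to $\mathbf P^{-1/2}\mathbf A\mathbf P^{-1/2}\mathbf v=\mathbf P^{-1/2}\mathbf b$ satisfy $$\|\mathbf r_k\|_2\le\omega^k\|\mathbf r_0\|_2\qquad(k\ge0),\qquad \mathbf r_k=\mathbf P^{-1/2}\mathbf b-\mathbf P^{-1/2}\mathbf A\mathbf P^{-1/2}\mathbf v_k,$$ where $$\omega=\sqrt{\frac{2+4\varsigma^2}{3+4\varsigma^2}}\in\Big[\sqrt{\tfrac23},1\Big),\qquad \varsigma=\frac32\max_{1\le i\le3}\tan\Big(\frac{\delta_i\pi}{2}\Big)\frac{|k_{i,+}-k_{i,-}|}{k_{i,+}+k_{i,-}},$$ so that $\omega$ depends only on the $\delta_i$ and $k_{i,\pm}$, and not on $N$. (With restarts, $k$ counts all inner iterations consecutively. Within a cycle that starts from $\mathbf v$ with residual $\mathbf r$, the $j$-th iterate minimizes the Euclidean norm of the residual over $\mathbf v+\operatorname{span}\{\mathbf r,\mathbf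 Z\mathbf r,\dots,\mathbf Z^{j-1}\mathbf r\}$, where $\mathbf Z=\mathbf P^{-1/2}\mathbf A\mathbf P^{-1/2}$.) -/

import Mathlib

open scoped Kronecker

noncomputable section

namespace FracFV

/-- The coefficients `s_k` of the finite volume discretization of a fractional derivative. -/
def sCoef (δ : ℝ) : ℕ → ℝ
  | 0 => (1 / 2 : ℝ) ^ δ
  | 1 => (3 / 2 : ℝ) ^ δ - 2 * (1 / 2 : ℝ) ^ δ
  | (k + 2) => (((k + 2 : ℕ) : ℝ) + 1 / 2) ^ δ - 2 * (((k + 2 : ℕ) : ℝ) - 1 / 2) ^ δ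
      + (((k + 2 : ℕ) : ℝ) - 3 / 2) ^ δ

/-- The Toeplitz coefficients: `q_0 = -s_0` and `q_k = s_{k-1} - s_k` for `k ≥ 1`. -/
def qCoef (δ : ℝ) : ℕ → ℝ
  | 0 => -sCoef δ 0
  | (k + 1) => sCoef δ k - sCoef δ (k + 1)

/-- The lower Hessenberg Toeplitz matrix with entry `q_{i-j+1}` in position `(i, j)`. -/
def toeplitzT (δ : ℝ) (n : ℕ) : Matrix (Fin n) (Fin n) ℝ :=
  Matrix.of fun i j => if (j : ℕ) ≤ (i : ℕ) + 1 then qCoef δ ((i : ℕ) + 1 - (j : ℕ)) else 0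

/-- The tridiagonal mass matrix `(1/8) tridiag(1, 6, 1)`. -/
def massA (n : ℕ) : Matrix (Fin n) (Fin n) ℝ :=
  Matrix.of fun i j =>
    if i = j then 6 / 8 else if (i : ℕ) + 1 = j ∨ (j : ℕ) + 1 = i then 1 / 8 else 0

/-- The stiffness matrix `k₊ T + k₋ Tᵀ`. -/
def stiffB (δ kp km : ℝ) (n : ℕ) : Matrix (Fin n) (Fin n) ℝ :=
  kp • toeplitzT δ n + km • (toeplitzT δ n).transpose

/-- The symmetric part `(Z + Zᵀ) / 2`. -/
def symPart {ι : Type*} (Z : Matrix ι ι ℝ) : Matrix ι ι ℝ :=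
  (1 / 2 : ℝ) • (Z + Z.transpose)

/-- The first column `t_0, …, t_{n-1}` of a matrix, continued by `t_l = 0` for `l ≥ n`. -/
def firstCol {n : ℕ} (C : Matrix (Fin n) (Fin n) ℝ) (l : ℕ) : ℝ :=
  if h : l < n then C ⟨l, h⟩ ⟨0, Nat.lt_of_le_of_lt (Nat.zero_le l) h⟩ else 0

/-- The `τ` matrix of a symmetric Toeplitz matrix `C = [t_{|i-j|}]`: `C` minus the Hankel matrix
whose antidiagonals are `t_2, …, t_{n-1}, 0, 0, 0, t_{n-1}, …, t_2`. With indices starting at `1`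
the Hankel entry is `t_{i+j} + t_{2(n+1)-(i+j)}`; here indices start at `0`. -/
def tauMatrix {n : ℕ} (C : Matrix (Fin n) (Fin n) ℝ) : Matrix (Fin n) (Fin n) ℝ :=
  Matrix.of fun i j =>
    C i j - (firstCol C ((i : ℕ) + j + 2) + firstCol C (2 * n - ((i : ℕ) + j)))

/-- Grid indices; with Kronecker products taken in the order `z ⊗ y ⊗ x` the `x`-index is the
fastest one. -/
abbrev Grid (n : Fin 3 → ℕ) : Type := (Fin (n 2) × Fin (n 1)) × Fin (n 0)

/-- `A_{n₃} ⊗ A_{n₂} ⊗ A_{n₁} + η₁ A_{n₃} ⊗ A_{n₂} ⊗ C₁ + η₂ A_{n₃} ⊗ C₂ ⊗ A_{n₁}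
+ η₃ C₃ ⊗ A_{n₂} ⊗ A_{n₁}`. -/
def threeLevel (n : Fin 3 → ℕ) (η : Fin 3 → ℝ)
    (C : (i : Fin 3) → Matrix (Fin (n i)) (Fin (n i)) ℝ) : Matrix (Grid n) (Grid n) ℝ :=
  massA (n 2) ⊗ₖ massA (n 1) ⊗ₖ massA (n 0)
    + η 0 • (massA (n 2) ⊗ₖ massA (n 1) ⊗ₖ C 0)
    + η 1 • (massA (n 2) ⊗ₖ C 1 ⊗ₖ massA (n 0))
    + η 2 • (C 2 ⊗ₖ massA (n 1) ⊗ₖ massA (n 0))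

/-- `η_i = Δt / (2 Γ(δ_i + 1) h_i^{2 - δ_i})`, with `Δt = T / M` and `h_i = (b_i - a_i)/(n_i + 1)`. -/
def eta (n : Fin 3 → ℕ) (a b : Fin 3 → ℝ) (T : ℝ) (M : ℕ) (δ : Fin 3 → ℝ) (i : Fin 3) : ℝ :=
  (T / M) / (2 * Real.Gamma (δ i + 1) * ((b i - a i) / ((n i : ℝ) + 1)) ^ (2 - δ i))

/-- The coefficient matrix `A` of the Crank–Nicolson finite volume scheme. -/
def coeffMatrix (n : Fin 3 → ℕ) (a b : Fin 3 → ℝ) (T : ℝ) (M : ℕ) (δ kp km : Fin 3 → ℝ) :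
    Matrix (Grid n) (Grid n) ℝ :=
  threeLevel n (eta n a b T M δ) fun i => stiffB (δ i) (kp i) (km i) (n i)

/-- The preconditioner `P`: each stiffness matrix is replaced by the `τ` matrix of its symmetric
part. -/
def precond (n : Fin 3 → ℕ) (a b : Fin 3 → ℝ) (T : ℝ) (M : ℕ) (δ kp km : Fin 3 → ℝ) :
    Matrix (Grid n) (Grid n) ℝ :=
  threeLevel n (eta n a b T M δ) fun i => tauMatrix (symPart (stiffB (δ i) (kp i) (km i) (n i)))

/-- `P^{-1/2}` for a positive definite matrix `P`, by the functional calculus of symmetric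
matrices. -/
def invSqrt {ι : Type*} [Fintype ι] [DecidableEq ι] (P : Matrix ι ι ℝ) : Matrix ι ι ℝ :=
  cfc (fun x : ℝ => x ^ (-(1 / 2) : ℝ)) P

/-- The two-sided preconditioned matrix `P^{-1/2} A P^{-1/2}`. -/
def twoSided (n : Fin 3 → ℕ) (a b : Fin 3 → ℝ) (T : ℝ) (M : ℕ) (δ kp km : Fin 3 → ℝ) :
    Matrix (Grid n) (Grid n) ℝ :=
  invSqrt (precond n a b T M δ kp km) * coeffMatrix n a b T M δ kp km
    * invSqrt (precond n a b T M δ kp km)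

section GMRES

variable {ι : Type*} [Fintype ι] [DecidableEq ι]

/-- The residual `w - Z v`. -/
def residual (Z : Matrix ι ι ℝ) (w v : EuclideanSpace ℝ ι) : EuclideanSpace ℝ ι :=
  w - Matrix.toEuclideanLin Z v

/-- The Krylov space `span {r, Z r, …, Z^{j-1} r}`. -/
def krylov (Z : Matrix ι ι ℝ) (r : EuclideanSpace ℝ ι) (j : ℕ) :
    Submodule ℝ (EuclideanSpace ℝ ι) :=
  Submodule.span ℝ (Set.range fun l : Fin j => Matrix.toEuclideanLin (Z ^ (l : ℕ)) r)

/-- `v` is the `j`-th GMRES iterate for `Z v = w` with initial guess `v₀`: it lies in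
`v₀ + K_j(Z, r₀)` and its residual has the least Euclidean norm there. -/
def IsGMRESIterate (Z : Matrix ι ι ℝ) (w v₀ : EuclideanSpace ℝ ι) (j : ℕ)
    (v : EuclideanSpace ℝ ι) : Prop :=
  v - v₀ ∈ krylov Z (residual Z w v₀) j ∧
    ∀ y : EuclideanSpace ℝ ι, y - v₀ ∈ krylov Z (residual Z w v₀) j →
      ‖residual Z w v‖ ≤ ‖residual Z w y‖

/-- `v 0, v 1, …` are the iterates of non-restarted GMRES with initial guess `v 0`. -/
def IsFullGMRES (Z : Matrix ι ι ℝ) (w : EuclideanSpace ℝ ι) (v : ℕ → EuclideanSpace ℝ ι) :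
    Prop :=
  ∀ k : ℕ, IsGMRESIterate Z w (v 0) k (v k)

/-- `v 0, v 1, …` are the iterates of GMRES restarted after every `m` steps, with initial guess
`v 0`; the inner iterates of all cycles are counted consecutively. -/
def IsRestartedGMRES (m : ℕ) (Z : Matrix ι ι ℝ) (w : EuclideanSpace ℝ ι)
    (v : ℕ → EuclideanSpace ℝ ι) : Prop :=
  ∀ c j : ℕ, j ≤ m → IsGMRESIterate Z w (v (c * m)) j (v (c * m + j))

end GMRES

/-- `ς = (3/2) max_i tan(δ_i π / 2) |k_{i,+} - k_{i,-}| / (k_{i,+} + k_{i,-})`. -/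
def varsig (δ kp km : Fin 3 → ℝ) : ℝ :=
  3 / 2 * Finset.univ.sup' Finset.univ_nonempty fun i : Fin 3 =>
    Real.tan (δ i / 2 * Real.pi) * (|kp i - km i| / (kp i + km i))

/-- `ω = √((2 + 4 ς²) / (3 + 4 ς²))`; it does not depend on the discretization. -/
def omegaRate (δ kp km : Fin 3 → ℝ) : ℝ :=
  Real.sqrt ((2 + 4 * varsig δ kp km ^ 2) / (3 + 4 * varsig δ kp km ^ 2))

end FracFV

end

/-!
The residual bound follows from three quadratic-form inequalities for `A` and `P`:
`P / 2 ≤ (A + Aᵀ) / 2 ≤ 3 P / 2`, and the sector condition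
`⟨x, A y⟩ - ⟨y, A x⟩ ≤ κ (⟨x, A x⟩ + ⟨y, A y⟩)` with `κ = 2 ς / 3`. They are inherited by
`Z = P^{-1/2} A P^{-1/2}`, with `P` replaced by the identity. If `H` and `S` are the symmetric and
the skew part of `Z`, then `Z r = H (r + H⁻¹ S r)`, where the two summands are `H`-orthogonal; hence
`‖Z r‖² ≤ L ⟨r, Z r⟩` with `L = 3/2 (1 + κ²)` (`mulVec_dotProduct_self_le`), so that
`‖r - L⁻¹ Z r‖² ≤ (2 + 3 κ²) / (3 + 3 κ²) ‖r‖²`, which is at most `ω² ‖r‖²`. A GMRES step is at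
least as good as this Richardson step, whether or not it follows a restart.

All three inequalities are sums of Kronecker products with positive definite mass matrices, so they
reduce to the one-dimensional stiffness matrices; for the sector condition this is seen on the
Hermitian matrix `κ (A + Aᵀ) + i (A - Aᵀ)` (`sectorMatrix`).

* The `τ` matrix. The first column `t` of the symmetric part satisfies `t_1 ≤ t_2 ≤ ⋯ ≤ 0` and
  `t_0 + 2 (t_1 + ⋯ + t_k) ≥ 0`. If `H` now denotes the Hankel matrix `C - τ(C)`, this makes both
  `C + H` and `C - 3 H` diagonally dominant, which is `τ(C) / 2 ≤ C ≤ 3 τ(C) / 2`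
  (`tauMatrix_symToeplitz_equiv`). The signs of the coefficients come from the differences of
  `x ^ δ`, except for `q_0 + q_2 ≤ q_3`, which amounts to `7^δ - 4·5^δ + 6·3^δ - 5 ≤ 0`.
* The sector condition. The entries of the Toeplitz matrix are third differences of the truncated
  power `x₊ ^ δ`. The integrals of `sin (x u) u^{-1-δ}` and `(1 - cos (x u)) u^{-1-δ}` over `u > 0`
  are `sgn x |x| ^ δ` and `|x| ^ δ` times constants `c` and `c'`. So the symmetric and the skew part
  of `T` are integrals of `cos ((i - j) u)` and `sin ((i - j) u)` against the same weight
  `8 sin³ (u/2) u^{-1-δ}`, up to the factors `1 / c` and `1 / c'`. Although `sin³ (u/2)` changes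
  sign, the weight gives nonnegative integrals to nonnegative `2π`-periodic functions, because
  `u^{-1-δ}` decreases (`integral_antiperiodic_mul_antitone_nonneg`). Finally
  `c / c' = tan (δ π / 2)`: the integral of `(1 - e^{-r u}) u^{-1-δ}` is a multiple of `r ^ δ` in
  the right half-plane, by scaling on the positive axis and the identity theorem, and `c' + i c` is
  its value at `r = i`.
-/

noncomputable section

namespace FracFV

/-! ### Signs and monotonicity of the Toeplitz coefficients -/

/-- The alternating iterated differences `(-1)^m Δ^m (x ↦ x ^ p)` with step `1`. -/
def altDiff (p : ℝ) : ℕ → ℝ → ℝ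
  | 0 => fun x => x ^ p
  | (m + 1) => fun x => altDiff p m x - altDiff p m (x + 1)

theorem hasDerivAt_altDiff (p : ℝ) (m : ℕ) {x : ℝ} (hx : 0 < x) :
    HasDerivAt (altDiff p m) (p * altDiff (p - 1) m x) x := by
  induction m generalizing x with
  | zero => simpa [altDiff] using Real.hasDerivAt_rpow_const (p := p) (Or.inl hx.ne')
  | succ m ih =>
    have h1 := ih hx
    have h2 := (ih (x := x + 1) (by linarith)).comp_add_const x 1
    have := h1.sub h2
    simp only [altDiff, mul_sub]
    exact this

theorem antitoneOn_altDiff {p : ℝ} {m : ℕ} (h : ∀ x, 0 < x → p * altDiff (p - 1) m x ≤ 0) :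
    AntitoneOn (altDiff p m) (Set.Ioi 0) := by
  refine antitoneOn_of_deriv_nonpos (convex_Ioi 0)
    (fun x hx => (hasDerivAt_altDiff p m hx).continuousAt.continuousWithinAt) ?_ ?_
  · rw [interior_Ioi]
    exact fun x hx => (hasDerivAt_altDiff p m hx).differentiableAt.differentiableWithinAt
  · rw [interior_Ioi]
    intro x hx
    rw [(hasDerivAt_altDiff p m hx).deriv]
    exact h x hx

/-- Negative powers are completely monotone. -/
theorem altDiff_nonneg {p : ℝ} (hp : p < 0) (m : ℕ) {x : ℝ} (hx : 0 < x) :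
    0 ≤ altDiff p m x := by
  induction m generalizing p x with
  | zero => exact Real.rpow_nonneg hx.le p
  | succ m ih =>
    have hanti : AntitoneOn (altDiff p m) (Set.Ioi 0) := antitoneOn_altDiff fun y hy =>
      mul_nonpos_of_nonpos_of_nonneg hp.le (ih (by linarith) hy)
    have := hanti (a := x) (b := x + 1) hx (by simp; linarith) (by linarith)
    simp only [altDiff]
    linarith

/-- Powers with exponent in `(0, 1)` are Bernstein functions: their alternating differences of
positive order are nonpositive. -/
theorem altDiff_succ_nonpos {p : ℝ} (hp : 0 < p) (hp1 : p < 1) (m : ℕ) {x : ℝ} (hx : 0 < x) :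
    altDiff p (m + 1) x ≤ 0 := by
  have hmono : MonotoneOn (altDiff p m) (Set.Ioi 0) := by
    refine monotoneOn_of_deriv_nonneg (convex_Ioi 0)
      (fun x hx => (hasDerivAt_altDiff p m hx).continuousAt.continuousWithinAt) ?_ ?_
    · rw [interior_Ioi]
      exact fun x hx => (hasDerivAt_altDiff p m hx).differentiableAt.differentiableWithinAt
    · rw [interior_Ioi]
      intro x hx
      rw [(hasDerivAt_altDiff p m hx).deriv]
      exact mul_nonneg hp.le (altDiff_nonneg (by linarith) m hx)
  have := hmono (a := x) (b := x + 1) hx (by simp; linarith) (by linarith)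
  simp only [altDiff]
  linarith

/-- The truncated power `x₊ ^ δ`. -/
def posPow (δ x : ℝ) : ℝ := max x 0 ^ δ

theorem posPow_of_nonneg (δ : ℝ) {x : ℝ} (hx : 0 ≤ x) : posPow δ x = x ^ δ := by
  rw [posPow, max_eq_left hx]

theorem posPow_of_nonpos {δ : ℝ} (hδ : 0 < δ) {x : ℝ} (hx : x ≤ 0) : posPow δ x = 0 := by
  rw [posPow, max_eq_right hx, Real.zero_rpow hδ.ne']

/-- The Toeplitz coefficients are third central differences of the truncated power. -/
theorem qCoef_eq {δ : ℝ} (hδ : 0 < δ) (k : ℕ) :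
    qCoef δ k = -(posPow δ (k + 1 / 2) - 3 * posPow δ (k - 1 / 2) + 3 * posPow δ (k - 3 / 2)
      - posPow δ (k - 5 / 2)) := by
  rcases k with _ | _ | _ | k
  · rw [posPow_of_nonneg _ (by norm_num), posPow_of_nonpos hδ (x := ((0 : ℕ) : ℝ) - 1 / 2)
      (by norm_num), posPow_of_nonpos hδ (x := ((0 : ℕ) : ℝ) - 3 / 2) (by norm_num),
      posPow_of_nonpos hδ (x := ((0 : ℕ) : ℝ) - 5 / 2) (by norm_num)]
    simp [qCoef, sCoef]
  · rw [posPow_of_nonneg _ (by norm_num), posPow_of_nonneg _ (by norm_num),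
      posPow_of_nonpos hδ (x := ((0 + 1 : ℕ) : ℝ) - 3 / 2) (by norm_num),
      posPow_of_nonpos hδ (x := ((0 + 1 : ℕ) : ℝ) - 5 / 2) (by norm_num)]
    simp only [qCoef, sCoef]
    norm_num
    ring
  · rw [posPow_of_nonneg _ (by norm_num), posPow_of_nonneg _ (by norm_num),
      posPow_of_nonneg _ (by norm_num),
      posPow_of_nonpos hδ (x := ((0 + 1 + 1 : ℕ) : ℝ) - 5 / 2) (by norm_num)]
    simp only [qCoef, sCoef]
    norm_num
    ring
  · have hk : (0 : ℝ) ≤ k := k.cast_nonneg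
    rw [posPow_of_nonneg _ (by push_cast; linarith), posPow_of_nonneg _ (by push_cast; linarith),
      posPow_of_nonneg _ (by push_cast; linarith), posPow_of_nonneg _ (by push_cast; linarith)]
    have e1 : ((k + 1 + 1 + 1 : ℕ) : ℝ) - 1 / 2 = (k : ℝ) + 5 / 2 := by push_cast; ring
    have e2 : ((k + 1 + 1 + 1 : ℕ) : ℝ) - 3 / 2 = (k : ℝ) + 3 / 2 := by push_cast; ring
    have e3 : ((k + 1 + 1 + 1 : ℕ) : ℝ) - 5 / 2 = (k : ℝ) + 1 / 2 := by push_cast; ring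
    have e4 : ((k + 1 + 1 + 1 : ℕ) : ℝ) + 1 / 2 = (k : ℝ) + 7 / 2 := by push_cast; ring
    have f1 : ((k + 2 : ℕ) : ℝ) + 1 / 2 = (k : ℝ) + 5 / 2 := by push_cast; ring
    have f2 : ((k + 2 : ℕ) : ℝ) - 1 / 2 = (k : ℝ) + 3 / 2 := by push_cast; ring
    have f3 : ((k + 2 : ℕ) : ℝ) - 3 / 2 = (k : ℝ) + 1 / 2 := by push_cast; ring
    have hs : sCoef δ (k + 1 + 1) = ((k : ℝ) + 5 / 2) ^ δ - 2 * ((k : ℝ) + 3 / 2) ^ δ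
        + ((k : ℝ) + 1 / 2) ^ δ := by
      rw [show k + 1 + 1 = k + 2 from rfl, sCoef, f1, f2, f3]
    have hs' : sCoef δ (k + 1 + 1 + 1) = ((k : ℝ) + 7 / 2) ^ δ - 2 * ((k : ℝ) + 5 / 2) ^ δ
        + ((k : ℝ) + 3 / 2) ^ δ := by
      rw [show k + 1 + 1 + 1 = (k + 1) + 2 from rfl, sCoef]
      rw [show k + 1 + 2 = k + 1 + 1 + 1 from rfl, e1, e2, e4]
    rw [qCoef, hs, hs', e1, e2, e3, e4]
    ring

theorem qCoef_add_three {δ : ℝ} (hδ : 0 < δ) (k : ℕ) :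
    qCoef δ (k + 3) = altDiff δ 3 (k + 1 / 2) := by
  have hk : (0 : ℝ) ≤ k := k.cast_nonneg
  rw [qCoef_eq hδ, posPow_of_nonneg _ (by push_cast; linarith),
    posPow_of_nonneg _ (by push_cast; linarith), posPow_of_nonneg _ (by push_cast; linarith),
    posPow_of_nonneg _ (by push_cast; linarith)]
  have e1 : ((k + 3 : ℕ) : ℝ) + 1 / 2 = k + 1 / 2 + 1 + 1 + 1 := by push_cast; ring
  have e2 : ((k + 3 : ℕ) : ℝ) - 1 / 2 = k + 1 / 2 + 1 + 1 := by push_cast; ring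
  have e3 : ((k + 3 : ℕ) : ℝ) - 3 / 2 = k + 1 / 2 + 1 := by push_cast; ring
  have e4 : ((k + 3 : ℕ) : ℝ) - 5 / 2 = k + 1 / 2 := by push_cast; ring
  rw [e1, e2, e3, e4]
  simp only [altDiff]
  ring

theorem qCoef_add_three_nonpos {δ : ℝ} (hδ : 0 < δ) (hδ1 : δ < 1) (k : ℕ) :
    qCoef δ (k + 3) ≤ 0 := by
  rw [qCoef_add_three hδ]
  exact altDiff_succ_nonpos hδ hδ1 2 (by positivity)

theorem qCoef_add_three_le_succ {δ : ℝ} (hδ : 0 < δ) (hδ1 : δ < 1) (k : ℕ) :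
    qCoef δ (k + 3) ≤ qCoef δ (k + 1 + 3) := by
  rw [qCoef_add_three hδ, qCoef_add_three hδ]
  have h := altDiff_succ_nonpos hδ hδ1 3 (x := k + 1 / 2) (by positivity)
  have e : (((k + 1 : ℕ) : ℝ)) + 1 / 2 = k + 1 / 2 + 1 := by push_cast; ring
  rw [e]
  rw [altDiff] at h
  linarith

theorem sCoef_add_two_nonpos {δ : ℝ} (hδ : 0 < δ) (hδ1 : δ < 1) (k : ℕ) :
    sCoef δ (k + 2) ≤ 0 := by
  have h := altDiff_succ_nonpos hδ hδ1 1 (x := k + 1 / 2) (by positivity)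
  have f1 : ((k + 2 : ℕ) : ℝ) + 1 / 2 = (k : ℝ) + 1 / 2 + 1 + 1 := by push_cast; ring
  have f2 : ((k + 2 : ℕ) : ℝ) - 1 / 2 = (k : ℝ) + 1 / 2 + 1 := by push_cast; ring
  have f3 : ((k + 2 : ℕ) : ℝ) - 3 / 2 = (k : ℝ) + 1 / 2 := by push_cast; ring
  rw [sCoef, f1, f2, f3]
  simp only [altDiff] at h
  linarith

theorem sum_range_qCoef (δ : ℝ) (k : ℕ) :
    ∑ l ∈ Finset.range (k + 1), qCoef δ l = -sCoef δ k := by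
  induction k with
  | zero => simp [qCoef]
  | succ k ih => rw [Finset.sum_range_succ, ih, qCoef]; ring

theorem qCoef_one_nonneg {δ : ℝ} (hδ1 : δ < 1) : 0 ≤ qCoef δ 1 := by
  have h3 : (3 : ℝ) ^ δ ≤ 3 := by
    simpa using Real.rpow_le_rpow_of_exponent_le (x := 3) (by norm_num) hδ1.le
  have h : (3 / 2 : ℝ) ^ δ = 3 ^ δ * (1 / 2) ^ δ := by
    rw [← Real.mul_rpow (by norm_num) (by norm_num)]; norm_num
  have hp : (0 : ℝ) ≤ (1 / 2 : ℝ) ^ δ := by positivity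
  simp only [qCoef, sCoef]
  rw [h]
  nlinarith

/-- The derivative of `7 ^ x - 4 * 5 ^ x + 6 * 3 ^ x - 5`, divided by `5 ^ x`, is a convex function
of `x`; its tangent at `x = 1` has a negative slope and a positive value. -/
theorem seven_five_three_deriv_nonneg {x : ℝ} (hx : x ≤ 1) :
    0 ≤ 7 ^ x * Real.log 7 - 4 * (5 ^ x * Real.log 5) + 6 * (3 ^ x * Real.log 3) := by
  have l3 : 0 < Real.log 3 := Real.log_pos (by norm_num)
  have l7 : 0 < Real.log 7 := Real.log_pos (by norm_num)
  have l75 : 0 < Real.log (7 / 5) := Real.log_pos (by norm_num)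
  have l53 : 0 < Real.log (5 / 3) := Real.log_pos (by norm_num)
  have tangent : ∀ b : ℝ, 0 < b → b * (1 + (x - 1) * Real.log b) ≤ b ^ x := by
    intro b hb
    have h1 : b ^ x = b * Real.exp ((x - 1) * Real.log b) := by
      rw [Real.rpow_def_of_pos hb]
      nth_rewrite 2 [← Real.exp_log hb]
      rw [← Real.exp_add]
      ring_nf
    rw [h1]
    have := Real.add_one_le_exp ((x - 1) * Real.log b)
    gcongr
    linarith
  have t1 := tangent (7 / 5) (by norm_num)
  have t2 := tangent (3 / 5) (by norm_num)
  have e35 : Real.log (3 / 5) = -Real.log (5 / 3) := by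
    rw [← Real.log_inv]; norm_num
  rw [e35] at t2
  have p7 : (7 : ℝ) ^ x = 5 ^ x * (7 / 5) ^ x := by
    rw [← Real.mul_rpow (by norm_num) (by norm_num)]; norm_num
  have p3 : (3 : ℝ) ^ x = 5 ^ x * (3 / 5) ^ x := by
    rw [← Real.mul_rpow (by norm_num) (by norm_num)]; norm_num
  have hval : 20 * Real.log 5 ≤ 7 * Real.log 7 + 18 * Real.log 3 := by
    have : Real.log (5 ^ 20) ≤ Real.log (7 ^ 7 * 3 ^ 18) :=
      Real.log_le_log (by norm_num) (by norm_num)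
    rw [Real.log_mul (by norm_num) (by norm_num), Real.log_pow, Real.log_pow, Real.log_pow] at this
    exact_mod_cast this
  have hs1 : Real.log 7 ≤ 2 * Real.log 3 := by
    have : Real.log 7 ≤ Real.log (3 ^ 2) := Real.log_le_log (by norm_num) (by norm_num)
    rw [Real.log_pow] at this
    exact_mod_cast this
  have hs2 : Real.log (7 / 5) ≤ Real.log (5 / 3) := Real.log_le_log (by norm_num) (by norm_num)
  have hslope : 7 * (Real.log 7 * Real.log (7 / 5)) ≤ 18 * (Real.log 3 * Real.log (5 / 3)) := by
    have h1 : Real.log 7 * Real.log (7 / 5) ≤ 2 * Real.log 3 * Real.log (5 / 3) :=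
      mul_le_mul hs1 hs2 l75.le (by positivity)
    have : 0 < Real.log 3 * Real.log (5 / 3) := mul_pos l3 l53
    nlinarith
  have key : 0 ≤ (7 / 5) ^ x * Real.log 7 - 4 * Real.log 5 + 6 * ((3 / 5) ^ x * Real.log 3) := by
    have m1 := mul_le_mul_of_nonneg_right t1 l7.le
    have m2 := mul_le_mul_of_nonneg_right t2 l3.le
    have m3 : 0 ≤ (1 - x) * (18 * (Real.log 3 * Real.log (5 / 3))
        - 7 * (Real.log 7 * Real.log (7 / 5))) := mul_nonneg (by linarith) (by linarith)
    nlinarith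
  rw [p7, p3]
  have h5 : (0 : ℝ) < 5 ^ x := by positivity
  nlinarith [mul_nonneg h5.le key]

theorem seven_five_three_nonpos {x : ℝ} (hx : x ≤ 1) :
    (7 : ℝ) ^ x - 4 * 5 ^ x + 6 * 3 ^ x - 5 ≤ 0 := by
  have hd : ∀ y : ℝ, HasDerivAt (fun y : ℝ => (7 : ℝ) ^ y - 4 * 5 ^ y + 6 * 3 ^ y - 5)
      (7 ^ y * Real.log 7 - 4 * (5 ^ y * Real.log 5) + 6 * (3 ^ y * Real.log 3)) y := by
    intro y
    have h7 := (Real.hasStrictDerivAt_const_rpow (a := 7) (by norm_num) y).hasDerivAt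
    have h5 := (Real.hasStrictDerivAt_const_rpow (a := 5) (by norm_num) y).hasDerivAt
    have h3 := (Real.hasStrictDerivAt_const_rpow (a := 3) (by norm_num) y).hasDerivAt
    exact ((h7.sub (h5.const_mul 4)).add (h3.const_mul 6)).sub_const 5
  have hmono : MonotoneOn (fun y : ℝ => (7 : ℝ) ^ y - 4 * 5 ^ y + 6 * 3 ^ y - 5) (Set.Iic 1) := by
    refine monotoneOn_of_deriv_nonneg (convex_Iic 1)
      (fun y _ => (hd y).continuousAt.continuousWithinAt)
      (fun y _ => (hd y).differentiableAt.differentiableWithinAt) ?_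
    rw [interior_Iic]
    intro y hy
    rw [(hd y).deriv]
    exact seven_five_three_deriv_nonneg (le_of_lt hy)
  have := hmono (a := x) (b := 1) hx (by simp) hx
  norm_num at this
  linarith

/-- The fourth difference of the power function that would give this inequality involves the point
`-1/2`, so `altDiff_succ_nonpos` does not apply; both sides agree at `δ = 1`. -/
theorem qCoef_zero_add_two_le {δ : ℝ} (hδ : 0 < δ) (hδ1 : δ < 1) :
    qCoef δ 0 + qCoef δ 2 ≤ qCoef δ 3 := by
  have h := seven_five_three_nonpos hδ1.le
  have hp : (0 : ℝ) ≤ (1 / 2 : ℝ) ^ δ := by positivity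
  have sc : ∀ a : ℝ, 0 ≤ a → (a / 2) ^ δ = a ^ δ * (1 / 2) ^ δ := by
    intro a ha
    rw [← Real.mul_rpow ha (by norm_num)]; ring_nf
  have s7 := sc 7 (by norm_num)
  have s5 := sc 5 (by norm_num)
  have s3 := sc 3 (by norm_num)
  have h3 := qCoef_add_three hδ 0
  simp only [zero_add, altDiff] at h3
  norm_num at h3
  rw [h3]
  simp only [qCoef, sCoef]
  norm_num at s7 s5 s3 hp ⊢
  rw [s7, s5, s3]
  nlinarith

/-- The first column of the symmetric part of the Toeplitz matrix. -/
def symCoef (δ : ℝ) : ℕ → ℝ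
  | 0 => qCoef δ 1
  | 1 => (qCoef δ 0 + qCoef δ 2) / 2
  | (k + 2) => qCoef δ (k + 3) / 2

theorem symCoef_succ_le {δ : ℝ} (hδ : 0 < δ) (hδ1 : δ < 1) (k : ℕ) :
    symCoef δ (k + 1) ≤ symCoef δ (k + 2) := by
  rcases k with _ | k
  · have := qCoef_zero_add_two_le hδ hδ1
    simp only [symCoef]
    linarith
  · have := qCoef_add_three_le_succ hδ hδ1 k
    simp only [symCoef]
    linarith

theorem symCoef_monotone {δ : ℝ} (hδ : 0 < δ) (hδ1 : δ < 1) :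
    Monotone fun k => symCoef δ (k + 1) :=
  monotone_nat_of_le_succ (symCoef_succ_le hδ hδ1)

theorem symCoef_succ_nonpos {δ : ℝ} (hδ : 0 < δ) (hδ1 : δ < 1) (k : ℕ) :
    symCoef δ (k + 1) ≤ 0 := by
  refine (symCoef_succ_le hδ hδ1 k).trans ?_
  have := qCoef_add_three_nonpos hδ hδ1 k
  simp only [symCoef]
  linarith

/-- Diagonal dominance: the partial sums of `t_0 + 2 (t_1 + t_2 + ⋯)` are `q_1` and, by
telescoping, the numbers `-s_k` with `k ≥ 2`. -/
theorem symCoef_zero_add_sum_nonneg {δ : ℝ} (hδ : 0 < δ) (hδ1 : δ < 1) (k : ℕ) :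
    0 ≤ symCoef δ 0 + 2 * ∑ l ∈ Finset.range k, symCoef δ (l + 1) := by
  rcases k with _ | k
  · simpa [symCoef] using qCoef_one_nonneg hδ1
  · have h : symCoef δ 0 + 2 * ∑ l ∈ Finset.range (k + 1), symCoef δ (l + 1)
        = ∑ l ∈ Finset.range (k + 3), qCoef δ l := by
      induction k with
      | zero => simp [symCoef, Finset.sum_range_succ]; ring
      | succ k ih =>
        rw [Finset.sum_range_succ, mul_add, ← add_assoc, ih, Finset.sum_range_succ _ (k + 3)]
        simp only [symCoef]
        ring
    rw [h, sum_range_qCoef]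
    have := sCoef_add_two_nonpos hδ hδ1 k
    linarith

/-! ### Integrals against the weight `u ^ (-1 - δ)` -/

section Integrals

open Set MeasureTheory Filter Topology

theorem integrableOn_rpow_mul_min {δ : ℝ} (hδ : 0 < δ) (hδ1 : δ < 1) :
    IntegrableOn (fun u : ℝ => u ^ (-1 - δ) * min 1 u) (Ioi 0) := by
  rw [← Ioc_union_Ioi_eq_Ioi (zero_le_one' ℝ)]
  refine IntegrableOn.union ?_ ?_
  · have h : IntegrableOn (fun u : ℝ => u ^ (-δ)) (Ioc 0 1) :=
      (intervalIntegrable_iff_integrableOn_Ioc_of_le zero_le_one).1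
        (intervalIntegral.intervalIntegrable_rpow' (by linarith))
    refine h.congr_fun (fun u hu => ?_) measurableSet_Ioc
    have : u ^ (-δ) = u ^ (-1 - δ) * u := by
      nth_rewrite 3 [← Real.rpow_one u]
      rw [← Real.rpow_add hu.1]
      ring_nf
    simp only [min_eq_right hu.2, this]
  · have h : IntegrableOn (fun u : ℝ => u ^ (-1 - δ)) (Ioi 1) :=
      integrableOn_Ioi_rpow_of_lt (by linarith) one_pos
    refine h.congr_fun (fun u hu => ?_) measurableSet_Ioi
    simp only [min_eq_left (le_of_lt (mem_Ioi.1 hu)), mul_one]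

theorem aestronglyMeasurable_weight_smul {E : Type*} [NormedAddCommGroup E] [NormedSpace ℝ E]
    (δ : ℝ) {f : ℝ → E} (hf : Continuous f) :
    AEStronglyMeasurable (fun u : ℝ => u ^ (-1 - δ) • f u) (volume.restrict (Ioi 0)) := by
  refine ContinuousOn.aestronglyMeasurable (fun u hu => ?_) measurableSet_Ioi
  exact ((Real.continuousAt_rpow_const u _ (Or.inl (ne_of_gt hu))).smul
    hf.continuousAt).continuousWithinAt

theorem integrableOn_weight_smul {E : Type*} [NormedAddCommGroup E] [NormedSpace ℝ E]
    {δ : ℝ} (hδ : 0 < δ) (hδ1 : δ < 1) {f : ℝ → E} (hf : Continuous f) (B : ℝ)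
    (hB : ∀ u, 0 < u → ‖f u‖ ≤ B * min 1 u) :
    IntegrableOn (fun u : ℝ => u ^ (-1 - δ) • f u) (Ioi 0) := by
  refine Integrable.mono' ((integrableOn_rpow_mul_min hδ hδ1).const_mul B)
    (aestronglyMeasurable_weight_smul δ hf) ?_
  filter_upwards [ae_restrict_mem measurableSet_Ioi] with u hu
  have hu0 : (0 : ℝ) ≤ u ^ (-1 - δ) := Real.rpow_nonneg (le_of_lt hu) _
  rw [norm_smul, Real.norm_of_nonneg hu0]
  calc u ^ (-1 - δ) * ‖f u‖ ≤ u ^ (-1 - δ) * (B * min 1 u) :=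
        mul_le_mul_of_nonneg_left (hB u hu) hu0
    _ = B * (u ^ (-1 - δ) * min 1 u) := by ring

theorem integral_weight_smul_comp_mul {E : Type*} [NormedAddCommGroup E] [NormedSpace ℝ E]
    (δ : ℝ) (f : ℝ → E) {x : ℝ} (hx : 0 < x) :
    ∫ u in Ioi (0 : ℝ), u ^ (-1 - δ) • f (x * u)
      = x ^ δ • ∫ u in Ioi (0 : ℝ), u ^ (-1 - δ) • f u := by
  have h := integral_comp_mul_left_Ioi (fun u : ℝ => u ^ (-1 - δ) • f u) 0 hx
  rw [mul_zero] at h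
  have e : x ^ δ = x ^ (1 + δ) * x⁻¹ := by
    rw [Real.rpow_add hx, Real.rpow_one]; field_simp
  rw [e, mul_smul, ← h, ← integral_smul]
  refine setIntegral_congr_fun measurableSet_Ioi fun u hu => ?_
  have hu' : (0 : ℝ) < u := hu
  have e2 : x ^ (1 + δ) * (x * u) ^ (-1 - δ) = u ^ (-1 - δ) := by
    rw [Real.mul_rpow hx.le hu'.le, ← mul_assoc, ← Real.rpow_add hx]
    norm_num
  simp only [smul_smul, e2]

theorem norm_one_sub_exp_le {z : ℂ} (hz : z.re ≤ 0) : ‖1 - Complex.exp z‖ ≤ 2 * min 1 ‖z‖ := by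
  rcases le_total ‖z‖ 1 with h | h
  · rw [min_eq_right h, norm_sub_rev]
    exact Complex.norm_exp_sub_one_le h
  · rw [min_eq_left h]
    calc ‖1 - Complex.exp z‖ ≤ ‖(1 : ℂ)‖ + ‖Complex.exp z‖ := norm_sub_le _ _
      _ ≤ 1 + 1 := by
        rw [norm_one, Complex.norm_exp]
        gcongr
        exact Real.exp_le_one_iff.2 hz
      _ = 2 * 1 := by norm_num

/-- The Bernstein representation of the power function: `∫ (1 - e^{-ru}) u^{-1-δ} du`, a constant
multiple of `r ^ δ` on the closed right half-plane. -/
def bernstein (δ : ℝ) (r : ℂ) : ℂ :=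
  ∫ u in Ioi (0 : ℝ), u ^ (-1 - δ) • (1 - Complex.exp (-(r * u)))

theorem norm_bernstein_integrand_le {r : ℂ} (hr : 0 ≤ r.re) {B : ℝ} (hB : ‖r‖ ≤ B) (hB1 : 1 ≤ B)
    {u : ℝ} (hu : 0 < u) : ‖1 - Complex.exp (-(r * u))‖ ≤ 2 * B * min 1 u := by
  have h := norm_one_sub_exp_le (z := -(r * u)) (by simpa using mul_nonneg hr hu.le)
  rw [norm_neg, norm_mul, Complex.norm_real, Real.norm_of_nonneg hu.le] at h
  refine h.trans ?_
  rw [mul_assoc]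
  gcongr
  rcases le_total 1 u with h1 | h1
  · rw [min_eq_left h1, mul_one]
    exact (min_le_left _ _).trans hB1
  · rw [min_eq_right h1]
    exact (min_le_right _ _).trans (by gcongr)

theorem integrableOn_bernstein {δ : ℝ} (hδ : 0 < δ) (hδ1 : δ < 1) {r : ℂ} (hr : 0 ≤ r.re) :
    IntegrableOn (fun u : ℝ => u ^ (-1 - δ) • (1 - Complex.exp (-(r * u)))) (Ioi 0) :=
  integrableOn_weight_smul hδ hδ1 (by fun_prop) (2 * (‖r‖ + 1)) fun _ hu =>
    norm_bernstein_integrand_le hr (by linarith) (by linarith [norm_nonneg r]) hu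

theorem differentiableAt_bernstein {δ : ℝ} (hδ : 0 < δ) (hδ1 : δ < 1) {r : ℂ} (hr : 0 < r.re) :
    DifferentiableAt ℂ (bernstein δ) r := by
  have hmem : {z : ℂ | r.re / 2 < z.re} ∈ 𝓝 r :=
    (isOpen_lt continuous_const Complex.continuous_re).mem_nhds (by simp; linarith)
  have hbound : IntegrableOn (fun u : ℝ => u ^ (-δ) * Real.exp (-(r.re / 2) * u)) (Ioi 0) := by
    have := integrableOn_rpow_mul_exp_neg_mul_rpow (p := 1) (s := -δ) (b := r.re / 2)
      (by linarith) one_pos (by linarith)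
    simpa using this
  have := hasDerivAt_integral_of_dominated_loc_of_deriv_le (𝕜 := ℂ) (μ := volume.restrict (Ioi 0))
    (F := fun (z : ℂ) (u : ℝ) => u ^ (-1 - δ) • (1 - Complex.exp (-(z * u))))
    (F' := fun (z : ℂ) (u : ℝ) => u ^ (-1 - δ) • (u * Complex.exp (-(z * u))))
    (bound := fun u : ℝ => u ^ (-δ) * Real.exp (-(r.re / 2) * u)) (x₀ := r) hmem
    (Eventually.of_forall fun z => aestronglyMeasurable_weight_smul δ (by fun_prop))
    (integrableOn_bernstein hδ hδ1 hr.le)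
    (aestronglyMeasurable_weight_smul δ (by fun_prop)) ?_ hbound ?_
  · exact this.2.differentiableAt
  · filter_upwards [ae_restrict_mem measurableSet_Ioi] with u hu z hz
    have hu' : (0 : ℝ) < u := hu
    have e : u ^ (-δ) = u ^ (-1 - δ) * u := by
      nth_rewrite 3 [← Real.rpow_one u]
      rw [← Real.rpow_add hu']
      ring_nf
    rw [norm_smul, norm_mul, Complex.norm_exp, Complex.norm_real, Real.norm_of_nonneg hu'.le,
      Real.norm_of_nonneg (Real.rpow_nonneg hu'.le _), ← mul_assoc, ← e]
    refine mul_le_mul_of_nonneg_left (Real.exp_le_exp.2 ?_) (Real.rpow_nonneg hu'.le _)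
    have hz' : r.re / 2 < z.re := hz
    simp
    nlinarith
  · filter_upwards with u z _
    have h1 : HasDerivAt (fun z : ℂ => -(z * u)) (-(u : ℂ)) z := by
      have h := ((hasDerivAt_id z).mul_const (u : ℂ)).neg
      rw [one_mul] at h
      exact h
    have h2 := ((h1.cexp).const_sub 1).const_smul (u ^ (-1 - δ))
    refine h2.congr_deriv ?_
    congr 1
    ring

theorem bernstein_ofReal (δ : ℝ) {x : ℝ} (hx : 0 < x) :
    bernstein δ x = bernstein δ 1 * (x : ℂ) ^ (δ : ℂ) := by
  have h := integral_weight_smul_comp_mul δ (fun u : ℝ => 1 - Complex.exp (-(u : ℂ))) hx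
  simp only [bernstein]
  push_cast at h
  rw [h, Complex.real_smul, Complex.ofReal_cpow hx.le, mul_comm]
  simp

theorem bernstein_eq {δ : ℝ} (hδ : 0 < δ) (hδ1 : δ < 1) {r : ℂ} (hr : 0 < r.re) :
    bernstein δ r = bernstein δ 1 * r ^ (δ : ℂ) := by
  have hopen : IsOpen {z : ℂ | 0 < z.re} := isOpen_lt continuous_const Complex.continuous_re
  have hf : AnalyticOnNhd ℂ (bernstein δ) {z : ℂ | 0 < z.re} :=
    DifferentiableOn.analyticOnNhd
      (fun z hz => (differentiableAt_bernstein hδ hδ1 hz).differentiableWithinAt) hopen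
  have hg : AnalyticOnNhd ℂ (fun z : ℂ => bernstein δ 1 * z ^ (δ : ℂ)) {z : ℂ | 0 < z.re} :=
    DifferentiableOn.analyticOnNhd (fun z hz => DifferentiableAt.differentiableWithinAt
      ((differentiableAt_id.cpow (differentiableAt_const _) (Or.inl hz)).const_mul _)) hopen
  refine hf.eqOn_of_preconnected_of_frequently_eq hg
    (convex_halfSpace_re_gt 0).isPreconnected (z₀ := 1) (by simp) ?_ hr
  -- the points `1 + 1 / (k + 1)` accumulate at `1`
  have hlim : Tendsto (fun k : ℕ => ((1 + 1 / ((k : ℝ) + 1) : ℝ) : ℂ)) atTop (𝓝[≠] 1) := by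
    refine tendsto_nhdsWithin_iff.2 ⟨?_, Eventually.of_forall fun k => ?_⟩
    · have h : Tendsto (fun k : ℕ => (1 + 1 / ((k : ℝ) + 1) : ℝ)) atTop (𝓝 (1 + 0)) :=
        tendsto_one_div_add_atTop_nhds_zero_nat.const_add 1
      rw [add_zero] at h
      have h' := (Complex.continuous_ofReal.tendsto 1).comp h
      rw [Complex.ofReal_one] at h'
      exact h'
    · have : (0 : ℝ) < 1 / ((k : ℝ) + 1) := by positivity
      rw [mem_compl_iff, mem_singleton_iff, Complex.ofReal_eq_one]
      linarith
  exact hlim.frequently (Frequently.of_forall fun k => bernstein_ofReal δ (by positivity))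

theorem bernstein_I {δ : ℝ} (hδ : 0 < δ) (hδ1 : δ < 1) :
    bernstein δ Complex.I = bernstein δ 1 * Complex.exp ((δ / 2 * Real.pi : ℝ) * Complex.I) := by
  have hpath : Tendsto (fun k : ℕ => ((1 / ((k : ℝ) + 1) : ℝ) : ℂ) + Complex.I) atTop
      (𝓝 Complex.I) := by
    have h := (Complex.continuous_ofReal.tendsto 0).comp
      (tendsto_one_div_add_atTop_nhds_zero_nat (𝕜 := ℝ))
    simpa using h.add_const Complex.I
  have hre : ∀ k : ℕ, 0 < (((1 / ((k : ℝ) + 1) : ℝ) : ℂ) + Complex.I).re := by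
    intro k
    rw [Complex.add_re, Complex.ofReal_re, Complex.I_re, add_zero]
    positivity
  have hleft : Tendsto (fun k : ℕ => bernstein δ (((1 / ((k : ℝ) + 1) : ℝ) : ℂ) + Complex.I))
      atTop (𝓝 (bernstein δ Complex.I)) := by
    refine tendsto_integral_of_dominated_convergence
      (fun u : ℝ => 2 * 2 * (u ^ (-1 - δ) * min 1 u))
      (fun k => aestronglyMeasurable_weight_smul δ (by fun_prop))
      ((integrableOn_rpow_mul_min hδ hδ1).const_mul _) (fun k => ?_) ?_
    · filter_upwards [ae_restrict_mem measurableSet_Ioi] with u hu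
      have hu0 : (0 : ℝ) ≤ u ^ (-1 - δ) := Real.rpow_nonneg (le_of_lt hu) _
      have hn : ‖((1 / ((k : ℝ) + 1) : ℝ) : ℂ) + Complex.I‖ ≤ 2 := by
        refine (norm_add_le _ _).trans ?_
        rw [Complex.norm_real, Complex.norm_I, Real.norm_of_nonneg (by positivity)]
        have : 1 / ((k : ℝ) + 1) ≤ 1 := by
          rw [div_le_one (by positivity)]
          linarith [(k.cast_nonneg : (0 : ℝ) ≤ k)]
        linarith
      have h := norm_bernstein_integrand_le (hre k).le hn (by norm_num) hu
      rw [norm_smul, Real.norm_of_nonneg hu0]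
      nlinarith [mul_le_mul_of_nonneg_left h hu0]
    · filter_upwards with u
      have hc : Continuous fun z : ℂ => u ^ (-1 - δ) • (1 - Complex.exp (-(z * u))) := by fun_prop
      exact (hc.tendsto _).comp hpath
  have hright : Tendsto (fun k : ℕ => bernstein δ 1
      * (((1 / ((k : ℝ) + 1) : ℝ) : ℂ) + Complex.I) ^ (δ : ℂ)) atTop
      (𝓝 (bernstein δ 1 * Complex.I ^ (δ : ℂ))) :=
    ((continuousAt_cpow_const (b := (δ : ℂ)) (a := Complex.I)
      (Or.inr (by simp))).tendsto.comp hpath).const_mul _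
  have heq : (fun k : ℕ => bernstein δ (((1 / ((k : ℝ) + 1) : ℝ) : ℂ) + Complex.I))
      = fun k : ℕ => bernstein δ 1 * (((1 / ((k : ℝ) + 1) : ℝ) : ℂ) + Complex.I) ^ (δ : ℂ) :=
    funext fun k => bernstein_eq hδ hδ1 (hre k)
  rw [tendsto_nhds_unique hleft (heq ▸ hright), Complex.cpow_def_of_ne_zero Complex.I_ne_zero,
    Complex.log_I]
  congr 2
  push_cast
  ring

/-- The sine constant `∫ sin u · u^{-1-δ} du`. -/
def sinInt (δ : ℝ) : ℝ := ∫ u in Ioi (0 : ℝ), u ^ (-1 - δ) • Real.sin u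

/-- The cosine constant `∫ (1 - cos u) u^{-1-δ} du`. -/
def cosInt (δ : ℝ) : ℝ := ∫ u in Ioi (0 : ℝ), u ^ (-1 - δ) • (1 - Real.cos u)

theorem bernstein_I_eq {δ : ℝ} (hδ : 0 < δ) (hδ1 : δ < 1) :
    (bernstein δ Complex.I).re = cosInt δ ∧ (bernstein δ Complex.I).im = sinInt δ := by
  have hint := integrableOn_bernstein hδ hδ1 (r := Complex.I) (by simp)
  have e : ∀ u : ℝ, -(Complex.I * (u : ℂ)) = ((-u : ℝ) : ℂ) * Complex.I := by
    intro u; push_cast; ring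
  constructor
  · have h := integral_re (𝕜 := ℂ) hint
    simp only [RCLike.re_to_complex] at h
    rw [bernstein, ← h, cosInt]
    refine setIntegral_congr_fun measurableSet_Ioi fun u _ => ?_
    simp only [e, Complex.real_smul, Complex.re_ofReal_mul, Complex.sub_re, Complex.one_re,
      Complex.exp_ofReal_mul_I_re, Real.cos_neg, smul_eq_mul]
  · have h := integral_im (𝕜 := ℂ) hint
    simp only [RCLike.im_to_complex] at h
    rw [bernstein, ← h, sinInt]
    refine setIntegral_congr_fun measurableSet_Ioi fun u _ => ?_
    simp only [e, Complex.real_smul, Complex.im_ofReal_mul, Complex.sub_im, Complex.one_im,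
      Complex.exp_ofReal_mul_I_im, Real.sin_neg, smul_eq_mul]
    ring

theorem bernstein_one {δ : ℝ} (hδ : 0 < δ) (hδ1 : δ < 1) :
    ∃ x : ℝ, 0 < x ∧ bernstein δ 1 = x := by
  have hint := integrableOn_weight_smul hδ hδ1 (f := fun u : ℝ => 1 - Real.exp (-u))
    (by fun_prop) (2 * 1) (fun u hu => by
      have := norm_bernstein_integrand_le (r := 1) (by simp) (B := 1) (by simp) le_rfl hu
      rw [one_mul] at this
      rw [← Complex.norm_real]
      push_cast
      exact this)
  refine ⟨∫ u in Ioi (0 : ℝ), u ^ (-1 - δ) • (1 - Real.exp (-u)), ?_, ?_⟩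
  · have hpos : ∀ u ∈ Ioi (0 : ℝ), 0 < u ^ (-1 - δ) • (1 - Real.exp (-u)) := fun u hu => by
      have hu' : (0 : ℝ) < u := hu
      have : Real.exp (-u) < 1 := by
        rw [← Real.exp_zero]; exact Real.exp_lt_exp.2 (by linarith)
      exact mul_pos (Real.rpow_pos_of_pos hu' _) (by linarith)
    refine (setIntegral_pos_iff_support_of_nonneg_ae ?_ hint).2 ?_
    · filter_upwards [ae_restrict_mem measurableSet_Ioi] with u hu using (hpos u hu).le
    · rw [inter_eq_right.2 fun u hu => Function.mem_support.2 (hpos u hu).ne']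
      simp
  · rw [← integral_complex_ofReal, bernstein]
    refine setIntegral_congr_fun measurableSet_Ioi fun u _ => ?_
    simp

theorem sinInt_pos_and_cosInt_pos_and_tan {δ : ℝ} (hδ : 0 < δ) (hδ1 : δ < 1) :
    0 < sinInt δ ∧ 0 < cosInt δ ∧ Real.tan (δ / 2 * Real.pi) = sinInt δ / cosInt δ := by
  obtain ⟨x, hx, hx1⟩ := bernstein_one hδ hδ1
  obtain ⟨hre, him⟩ := bernstein_I_eq hδ hδ1
  rw [bernstein_I hδ hδ1, hx1, Complex.re_ofReal_mul, Complex.exp_ofReal_mul_I_re] at hre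
  rw [bernstein_I hδ hδ1, hx1, Complex.im_ofReal_mul, Complex.exp_ofReal_mul_I_im] at him
  have hpi := Real.pi_pos
  have hs : 0 < Real.sin (δ / 2 * Real.pi) :=
    Real.sin_pos_of_pos_of_lt_pi (by positivity) (by nlinarith)
  have hc : 0 < Real.cos (δ / 2 * Real.pi) :=
    Real.cos_pos_of_mem_Ioo ⟨by nlinarith, by nlinarith⟩
  rw [← hre, ← him, Real.tan_eq_sin_div_cos]
  exact ⟨mul_pos hx hs, mul_pos hx hc, by field_simp⟩

theorem abs_sin_le_min {u : ℝ} (hu : 0 < u) : |Real.sin u| ≤ min 1 u :=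
  le_min (Real.abs_sin_le_one u) (by simpa [abs_of_pos hu] using Real.abs_sin_le_abs (x := u))

/-- The sine transform of the weight is an odd power function. -/
theorem integral_sin_mul {δ : ℝ} (hδ : 0 < δ) (x : ℝ) :
    ∫ u in Ioi (0 : ℝ), u ^ (-1 - δ) • Real.sin (x * u)
      = sinInt δ * (posPow δ x - posPow δ (-x)) := by
  rcases lt_trichotomy x 0 with hx | rfl | hx
  · have h := integral_weight_smul_comp_mul δ Real.sin (neg_pos.2 hx)
    rw [posPow_of_nonpos hδ hx.le, posPow_of_nonneg δ (neg_pos.2 hx).le]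
    simp only [neg_mul, Real.sin_neg, smul_neg, integral_neg] at h
    rw [sinInt, ← neg_inj, h, smul_eq_mul]
    ring
  · simp [posPow_of_nonpos hδ]
  · rw [posPow_of_nonneg δ hx.le, posPow_of_nonpos hδ (by linarith : -x ≤ 0),
      integral_weight_smul_comp_mul δ Real.sin hx, sinInt, smul_eq_mul]
    ring

/-- The regularized cosine transform of the weight is an even power function. -/
theorem integral_one_sub_cos_mul {δ : ℝ} (hδ : 0 < δ) (x : ℝ) :
    ∫ u in Ioi (0 : ℝ), u ^ (-1 - δ) • (1 - Real.cos (x * u))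
      = cosInt δ * (posPow δ x + posPow δ (-x)) := by
  rcases lt_trichotomy x 0 with hx | rfl | hx
  · have h := integral_weight_smul_comp_mul δ (fun u => 1 - Real.cos u) (neg_pos.2 hx)
    rw [posPow_of_nonpos hδ hx.le, posPow_of_nonneg δ (neg_pos.2 hx).le]
    simp only [neg_mul, Real.cos_neg] at h
    rw [cosInt, h, smul_eq_mul]
    ring
  · simp [posPow_of_nonpos hδ]
  · rw [posPow_of_nonneg δ hx.le, posPow_of_nonpos hδ (by linarith : -x ≤ 0),
      integral_weight_smul_comp_mul δ (fun u => 1 - Real.cos u) hx, cosInt, smul_eq_mul]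
    ring

/-- An antiperiodic function that is nonnegative on its first half-period has a nonnegative
integral against every decreasing weight: consecutive half-periods are compared. -/
theorem integral_antiperiodic_mul_antitone_nonneg {w h : ℝ → ℝ} {p : ℝ} (hp : 0 < p)
    (hint : IntegrableOn (fun u => w u * h u) (Ioi 0)) (hw : AntitoneOn w (Ioi 0))
    (hper : ∀ u, h (u + p) = -h u) (hpos : ∀ u ∈ Icc 0 p, 0 ≤ h u) :
    0 ≤ ∫ u in Ioi (0 : ℝ), w u * h u := by
  have hii : ∀ a b : ℝ, 0 ≤ a → a ≤ b → IntervalIntegrable (fun u => w u * h u) volume a b :=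
    fun a b ha hab => (intervalIntegrable_iff_integrableOn_Ioc_of_le hab).2
      (hint.mono_set fun u hu => lt_of_le_of_lt ha hu.1)
  have hshift : ∀ (k : ℕ) (u : ℝ), h (u + 2 * p * k) = h u := by
    intro k u
    induction k with
    | zero => simp
    | succ k ih =>
      rw [show u + 2 * p * ((k + 1 : ℕ) : ℝ) = u + 2 * p * k + p + p by push_cast; ring, hper,
        hper, neg_neg, ih]
  have hstep : ∀ k : ℕ, 0 ≤ ∫ u in (2 * p * k)..(2 * p * k + 2 * p), w u * h u := by
    intro k
    have ha : (0 : ℝ) ≤ 2 * p * k := by positivity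
    set a : ℝ := 2 * p * k with ha_def
    rw [← intervalIntegral.integral_add_adjacent_intervals (hii a (a + p) ha (by linarith))
      (hii (a + p) (a + 2 * p) (by linarith) (by linarith))]
    have e : ∫ u in (a + p)..(a + 2 * p), w u * h u = -∫ u in a..(a + p), w (u + p) * h u := by
      rw [← intervalIntegral.integral_neg, show a + 2 * p = a + p + p by ring,
        ← intervalIntegral.integral_comp_add_right]
      refine intervalIntegral.integral_congr fun u _ => ?_
      simp only [hper]
      ring
    have hii2 : IntervalIntegrable (fun u => w (u + p) * h u) volume a (a + p) := by
      have := (hii (a + p) (a + p + p) (by linarith) (by linarith)).comp_add_right p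
      simp only [hper] at this
      have h' := this.neg
      rw [add_sub_cancel_right, add_sub_cancel_right] at h'
      refine h'.congr fun u _ => ?_
      simp
    rw [e, ← sub_eq_add_neg, ← intervalIntegral.integral_sub (hii a (a + p) ha (by linarith)) hii2]
    refine intervalIntegral.integral_nonneg_of_ae_restrict (by linarith) ?_
    have hne : ∀ᵐ u ∂(volume.restrict (Icc a (a + p))), u ≠ a :=
      ae_restrict_of_ae (Measure.ae_ne volume a)
    filter_upwards [ae_restrict_mem measurableSet_Icc, hne] with u hu hua
    have hu1 : a < u := lt_of_le_of_ne hu.1 (Ne.symm hua)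
    have hh : 0 ≤ h u := by
      have := hshift k (u - a)
      rw [← ha_def, sub_add_cancel] at this
      rw [this]
      exact hpos _ ⟨by linarith, by linarith [hu.2]⟩
    have hw' : w (u + p) ≤ w u :=
      hw (mem_Ioi.2 (by linarith)) (mem_Ioi.2 (by linarith)) (by linarith)
    have : 0 ≤ (w u - w (u + p)) * h u := mul_nonneg (by linarith) hh
    simp only [Pi.zero_apply]
    linarith
  have hN : ∀ k : ℕ, 0 ≤ ∫ u in (0 : ℝ)..(2 * p * k), w u * h u := by
    intro k
    induction k with
    | zero => simp
    | succ k ih =>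
      have hk : (0 : ℝ) ≤ 2 * p * k := by positivity
      rw [show 2 * p * ((k + 1 : ℕ) : ℝ) = 2 * p * k + 2 * p by push_cast; ring,
        ← intervalIntegral.integral_add_adjacent_intervals (hii 0 _ le_rfl hk)
          (hii _ _ hk (by linarith))]
      exact add_nonneg ih (hstep k)
  have hlim : Tendsto (fun k : ℕ => 2 * p * (k : ℝ)) atTop atTop :=
    tendsto_natCast_atTop_atTop.const_mul_atTop (by positivity)
  exact ge_of_tendsto' (intervalIntegral_tendsto_integral_Ioi 0 hint hlim) hN

end Integrals

/-! ### The numerical range of the Toeplitz matrix -/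

section ToeplitzRange

open Set MeasureTheory Matrix

/-- The negative third central difference of the truncated power. -/
def thirdDiff (δ d : ℝ) : ℝ :=
  -(posPow δ (d + 3 / 2) - 3 * posPow δ (d + 1 / 2) + 3 * posPow δ (d - 1 / 2)
    - posPow δ (d - 3 / 2))

theorem toeplitzT_apply {δ : ℝ} (hδ : 0 < δ) {n : ℕ} (i j : Fin n) :
    toeplitzT δ n i j = thirdDiff δ ((i : ℝ) - (j : ℝ)) := by
  rw [toeplitzT, of_apply]
  split_ifs with h
  · rw [qCoef_eq hδ, thirdDiff, Nat.cast_sub h]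
    push_cast
    ring_nf
  · have h' : ((i : ℕ) : ℝ) + 2 ≤ (j : ℕ) := by
      have : (i : ℕ) + 2 ≤ (j : ℕ) := by omega
      exact_mod_cast this
    rw [thirdDiff, posPow_of_nonpos hδ (by linarith), posPow_of_nonpos hδ (by linarith),
      posPow_of_nonpos hδ (by linarith), posPow_of_nonpos hδ (by linarith)]
    ring

theorem integrableOn_sin_mul {δ : ℝ} (hδ : 0 < δ) (hδ1 : δ < 1) (x : ℝ) :
    IntegrableOn (fun u : ℝ => u ^ (-1 - δ) • Real.sin (x * u)) (Ioi 0) := by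
  refine integrableOn_weight_smul hδ hδ1 (by fun_prop) (1 + |x|) fun u hu => ?_
  rw [Real.norm_eq_abs]
  have hx := abs_nonneg x
  rcases le_total 1 u with h | h
  · rw [min_eq_left h]
    linarith [Real.abs_sin_le_one (x * u)]
  · rw [min_eq_right h]
    have := Real.abs_sin_le_abs (x := x * u)
    rw [abs_mul, abs_of_pos hu] at this
    nlinarith

theorem integrableOn_one_sub_cos_mul {δ : ℝ} (hδ : 0 < δ) (hδ1 : δ < 1) (x : ℝ) :
    IntegrableOn (fun u : ℝ => u ^ (-1 - δ) • (1 - Real.cos (x * u))) (Ioi 0) := by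
  refine integrableOn_weight_smul hδ hδ1 (by fun_prop) (2 + |x|) fun u hu => ?_
  have hx := abs_nonneg x
  rw [Real.norm_of_nonneg (by linarith [Real.cos_le_one (x * u)])]
  rcases le_total 1 u with h | h
  · rw [min_eq_left h]
    linarith [Real.neg_one_le_cos (x * u)]
  · rw [min_eq_right h]
    have h1 := Real.abs_sin_le_abs (x := x * u / 2)
    have h2 := Real.abs_sin_le_one (x * u / 2)
    have h3 : Real.cos (x * u) = 1 - 2 * Real.sin (x * u / 2) ^ 2 := by
      rw [Real.sin_sq, show x * u = 2 * (x * u / 2) by ring, Real.cos_two_mul]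
      ring_nf
    have h4 : |x * u / 2| = |x| * u / 2 := by
      rw [abs_div, abs_mul, abs_of_pos hu, abs_of_pos (by norm_num : (0 : ℝ) < 2)]
    rw [h4] at h1
    rw [h3, ← sq_abs]
    nlinarith [abs_nonneg (Real.sin (x * u / 2))]

theorem integral_neg_add_three_mul {f₁ f₂ f₃ f₄ : ℝ → ℝ} {s : Set ℝ} (h₁ : IntegrableOn f₁ s)
    (h₂ : IntegrableOn f₂ s) (h₃ : IntegrableOn f₃ s) (h₄ : IntegrableOn f₄ s) :
    ∫ u in s, (-f₁ u + 3 * f₂ u - 3 * f₃ u + f₄ u)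
      = -(∫ u in s, f₁ u) + 3 * (∫ u in s, f₂ u) - 3 * (∫ u in s, f₃ u) + ∫ u in s, f₄ u := by
  have h₁₂ : IntegrableOn (fun u => -f₁ u + 3 * f₂ u) s := h₁.neg.add (h₂.const_mul 3)
  have h₁₂₃ : IntegrableOn (fun u => -f₁ u + 3 * f₂ u - 3 * f₃ u) s := h₁₂.sub (h₃.const_mul 3)
  rw [integral_add h₁₂₃ h₄, integral_sub h₁₂ (h₃.const_mul 3),
    integral_add (f := fun u => -f₁ u) h₁.neg (h₂.const_mul 3), integral_neg, integral_const_mul,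
    integral_const_mul]

theorem eight_sin_half_cube (u : ℝ) :
    8 * Real.sin (u / 2) ^ 3 = 6 * Real.sin (u / 2) - 2 * Real.sin (3 * (u / 2)) := by
  rw [Real.sin_three_mul]
  ring

/-- The cosine representation of the even part of the third difference. -/
theorem sinInt_mul_thirdDiff_add {δ : ℝ} (hδ : 0 < δ) (hδ1 : δ < 1) (d : ℝ) :
    sinInt δ * (thirdDiff δ d + thirdDiff δ (-d))
      = ∫ u in Ioi (0 : ℝ), u ^ (-1 - δ) • (8 * Real.sin (u / 2) ^ 3 * Real.cos (d * u)) := by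
  have hS : ∀ x, IntegrableOn (fun u : ℝ => u ^ (-1 - δ) • Real.sin (x * u)) (Ioi 0) :=
    integrableOn_sin_mul hδ hδ1
  have hI := integral_sin_mul hδ
  have e : ∀ u : ℝ, u ^ (-1 - δ) • (8 * Real.sin (u / 2) ^ 3 * Real.cos (d * u))
      = -(u ^ (-1 - δ) • Real.sin ((d + 3 / 2) * u))
        + 3 * (u ^ (-1 - δ) • Real.sin ((d + 1 / 2) * u))
        - 3 * (u ^ (-1 - δ) • Real.sin ((d - 1 / 2) * u))
        + u ^ (-1 - δ) • Real.sin ((d - 3 / 2) * u) := by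
    intro u
    rw [eight_sin_half_cube, show (d + 3 / 2) * u = d * u + 3 * (u / 2) by ring,
      show (d + 1 / 2) * u = d * u + u / 2 by ring, show (d - 1 / 2) * u = d * u - u / 2 by ring,
      show (d - 3 / 2) * u = d * u - 3 * (u / 2) by ring, Real.sin_add, Real.sin_add,
      Real.sin_sub, Real.sin_sub]
    simp only [smul_eq_mul]
    ring
  simp only [e]
  rw [integral_neg_add_three_mul (hS _) (hS _) (hS _) (hS _), hI, hI, hI, hI, thirdDiff, thirdDiff]
  rw [show -(d + 3 / 2) = -d - 3 / 2 by ring, show -(d + 1 / 2) = -d - 1 / 2 by ring,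
    show -(d - 3 / 2) = -d + 3 / 2 by ring, show -(d - 1 / 2) = -d + 1 / 2 by ring]
  ring

/-- The sine representation of the odd part, with the weight of `sinInt_mul_thirdDiff_add` and
another constant. -/
theorem cosInt_mul_thirdDiff_sub {δ : ℝ} (hδ : 0 < δ) (hδ1 : δ < 1) (d : ℝ) :
    cosInt δ * (thirdDiff δ d - thirdDiff δ (-d))
      = ∫ u in Ioi (0 : ℝ), u ^ (-1 - δ) • (8 * Real.sin (u / 2) ^ 3 * Real.sin (d * u)) := by
  have hS : ∀ x, IntegrableOn (fun u : ℝ => u ^ (-1 - δ) • (1 - Real.cos (x * u))) (Ioi 0) :=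
    integrableOn_one_sub_cos_mul hδ hδ1
  have hI := integral_one_sub_cos_mul hδ
  have e : ∀ u : ℝ, u ^ (-1 - δ) • (8 * Real.sin (u / 2) ^ 3 * Real.sin (d * u))
      = -(u ^ (-1 - δ) • (1 - Real.cos ((d + 3 / 2) * u)))
        + 3 * (u ^ (-1 - δ) • (1 - Real.cos ((d + 1 / 2) * u)))
        - 3 * (u ^ (-1 - δ) • (1 - Real.cos ((d - 1 / 2) * u)))
        + u ^ (-1 - δ) • (1 - Real.cos ((d - 3 / 2) * u)) := by
    intro u
    rw [eight_sin_half_cube, show (d + 3 / 2) * u = d * u + 3 * (u / 2) by ring,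
      show (d + 1 / 2) * u = d * u + u / 2 by ring, show (d - 1 / 2) * u = d * u - u / 2 by ring,
      show (d - 3 / 2) * u = d * u - 3 * (u / 2) by ring, Real.cos_add, Real.cos_add,
      Real.cos_sub, Real.cos_sub]
    simp only [smul_eq_mul]
    ring
  simp only [e]
  rw [integral_neg_add_three_mul (hS _) (hS _) (hS _) (hS _), hI, hI, hI, hI, thirdDiff, thirdDiff]
  rw [show -(d + 3 / 2) = -d - 3 / 2 by ring, show -(d + 1 / 2) = -d - 1 / 2 by ring,
    show -(d - 3 / 2) = -d + 3 / 2 by ring, show -(d - 1 / 2) = -d + 1 / 2 by ring]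
  ring

theorem integrableOn_sin_cube_mul {δ : ℝ} (hδ : 0 < δ) (hδ1 : δ < 1) {g : ℝ → ℝ}
    (hg : Continuous g) (hg1 : ∀ u, |g u| ≤ 1) :
    IntegrableOn (fun u : ℝ => u ^ (-1 - δ) • (8 * Real.sin (u / 2) ^ 3 * g u)) (Ioi 0) := by
  refine integrableOn_weight_smul hδ hδ1 (by fun_prop) 8 fun u hu => ?_
  have h0 : |Real.sin (u / 2)| ≤ min 1 u :=
    (abs_sin_le_min (half_pos hu)).trans (min_le_min le_rfl (by linarith))
  have h1 := Real.abs_sin_le_one (u / 2)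
  rw [Real.norm_eq_abs, abs_mul, abs_mul, abs_pow, abs_of_pos (by norm_num : (0 : ℝ) < 8)]
  calc 8 * |Real.sin (u / 2)| ^ 3 * |g u| ≤ 8 * |Real.sin (u / 2)| ^ 1 * 1 := by
        gcongr 8 * ?_ * ?_
        · exact pow_le_pow_of_le_one (abs_nonneg _) h1 (by norm_num)
        · exact hg1 u
    _ ≤ 8 * min 1 u := by linarith

theorem sum_sum_cos_sin {n : ℕ} (x y : Fin n → ℝ) (u : ℝ) :
    ∑ i : Fin n, ∑ j : Fin n, (Real.cos (((i : ℝ) - (j : ℝ)) * u) * (x i * x j + y i * y j)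
        - 2 * (Real.sin (((i : ℝ) - (j : ℝ)) * u) * (x i * y j)))
      = ((∑ i, x i * Real.sin (i * u)) - ∑ i, y i * Real.cos (i * u)) ^ 2
        + ((∑ i, x i * Real.cos (i * u)) + ∑ i, y i * Real.sin (i * u)) ^ 2 := by
  have e : ∀ i j : Fin n, Real.cos (((i : ℝ) - (j : ℝ)) * u) * (x i * x j + y i * y j)
        - 2 * (Real.sin (((i : ℝ) - (j : ℝ)) * u) * (x i * y j))
      = (x i * Real.cos (i * u)) * (x j * Real.cos (j * u))
        + (x i * Real.sin (i * u)) * (x j * Real.sin (j * u))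
        + (y i * Real.cos (i * u)) * (y j * Real.cos (j * u))
        + (y i * Real.sin (i * u)) * (y j * Real.sin (j * u))
        - 2 * ((x i * Real.sin (i * u)) * (y j * Real.cos (j * u)))
        + 2 * ((x i * Real.cos (i * u)) * (y j * Real.sin (j * u))) := by
    intro i j
    rw [sub_mul, Real.cos_sub, Real.sin_sub]
    ring
  simp only [e, Finset.sum_add_distrib, Finset.sum_sub_distrib, ← Finset.mul_sum,
    ← Finset.sum_mul]
  ring

/-- The numerical range of `T` lies in a sector with half-angle `δ π / 2`. In the Fourier
representation the Hermitian matrix `tan (δ π / 2) (T + Tᵀ) ± i (T - Tᵀ)` is a multiple of an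
integral of rank-one matrices `[e^{i(j-k)u}]` against `sin³ (u/2) u^{-1-δ}`. -/
theorem toeplitzT_sector {δ : ℝ} (hδ : 0 < δ) (hδ1 : δ < 1) {n : ℕ} (x y : Fin n → ℝ) :
    x ⬝ᵥ toeplitzT δ n *ᵥ y - y ⬝ᵥ toeplitzT δ n *ᵥ x
      ≤ Real.tan (δ / 2 * Real.pi)
        * (x ⬝ᵥ toeplitzT δ n *ᵥ x + y ⬝ᵥ toeplitzT δ n *ᵥ y) := by
  obtain ⟨hs, hc, ht⟩ := sinInt_pos_and_cosInt_pos_and_tan hδ hδ1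
  set D : Fin n → Fin n → ℝ := fun i j => thirdDiff δ ((i : ℝ) - (j : ℝ)) with hD
  have hform : ∀ p q : Fin n → ℝ,
      p ⬝ᵥ toeplitzT δ n *ᵥ q = ∑ i, ∑ j, D i j * (p i * q j) := by
    intro p q
    simp only [dotProduct, mulVec, toeplitzT_apply hδ, Finset.mul_sum, hD]
    exact Finset.sum_congr rfl fun i _ => Finset.sum_congr rfl fun j _ => by ring
  have hswap : ∀ p q : Fin n → ℝ,
      ∑ i, ∑ j, D i j * (p i * q j) = ∑ i, ∑ j, D j i * (q i * p j) := by
    intro p q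
    rw [Finset.sum_comm]
    exact Finset.sum_congr rfl fun i _ => Finset.sum_congr rfl fun j _ => by ring
  have hDt : ∀ i j : Fin n, D j i = thirdDiff δ (-((i : ℝ) - (j : ℝ))) := by
    intro i j; simp only [hD, neg_sub]
  have hquad : ∀ p : Fin n → ℝ, p ⬝ᵥ toeplitzT δ n *ᵥ p
      = ∑ i, ∑ j, (D i j + D j i) / 2 * (p i * p j) := by
    intro p
    have h1 := hform p p
    have h2 := h1
    rw [hswap] at h2
    have : p ⬝ᵥ toeplitzT δ n *ᵥ p = (1 / 2) * (∑ i, ∑ j, D i j * (p i * p j))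
        + (1 / 2) * ∑ i, ∑ j, D j i * (p i * p j) := by linarith
    rw [this, Finset.mul_sum, Finset.mul_sum, ← Finset.sum_add_distrib]
    refine Finset.sum_congr rfl fun i _ => ?_
    rw [Finset.mul_sum, Finset.mul_sum, ← Finset.sum_add_distrib]
    exact Finset.sum_congr rfl fun j _ => by ring
  -- the integral that represents the difference of the two sides
  set G : ℝ → ℝ := fun u => ((∑ i, x i * Real.sin (i * u)) - ∑ i, y i * Real.cos (i * u)) ^ 2
        + ((∑ i, x i * Real.cos (i * u)) + ∑ i, y i * Real.sin (i * u)) ^ 2 with hG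
  have hIc : ∀ i j : Fin n, IntegrableOn (fun u : ℝ => u ^ (-1 - δ) •
      (8 * Real.sin (u / 2) ^ 3 * Real.cos (((i : ℝ) - (j : ℝ)) * u))) (Ioi 0) := fun i j =>
    integrableOn_sin_cube_mul hδ hδ1 (by fun_prop) fun u => Real.abs_cos_le_one _
  have hIs : ∀ i j : Fin n, IntegrableOn (fun u : ℝ => u ^ (-1 - δ) •
      (8 * Real.sin (u / 2) ^ 3 * Real.sin (((i : ℝ) - (j : ℝ)) * u))) (Ioi 0) := fun i j =>
    integrableOn_sin_cube_mul hδ hδ1 (by fun_prop) fun u => Real.abs_sin_le_one _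
  have hexp : ∀ u : ℝ, u ^ (-1 - δ) * (8 * Real.sin (u / 2) ^ 3 * G u)
      = ∑ i : Fin n, ∑ j : Fin n, ((u ^ (-1 - δ) • (8 * Real.sin (u / 2) ^ 3
            * Real.cos (((i : ℝ) - (j : ℝ)) * u))) * (x i * x j + y i * y j)
          - (u ^ (-1 - δ) • (8 * Real.sin (u / 2) ^ 3
            * Real.sin (((i : ℝ) - (j : ℝ)) * u))) * (2 * (x i * y j))) := by
    intro u
    simp only [hG]
    rw [← sum_sum_cos_sin, Finset.mul_sum, Finset.mul_sum]
    refine Finset.sum_congr rfl fun i _ => ?_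
    rw [Finset.mul_sum, Finset.mul_sum]
    refine Finset.sum_congr rfl fun j _ => ?_
    simp only [smul_eq_mul]
    ring
  have hI2 : ∀ i j : Fin n, IntegrableOn (fun u : ℝ => (u ^ (-1 - δ) • (8 * Real.sin (u / 2) ^ 3
            * Real.cos (((i : ℝ) - (j : ℝ)) * u))) * (x i * x j + y i * y j)
          - (u ^ (-1 - δ) • (8 * Real.sin (u / 2) ^ 3
            * Real.sin (((i : ℝ) - (j : ℝ)) * u))) * (2 * (x i * y j))) (Ioi 0) := fun i j =>
    ((hIc i j).mul_const _).sub ((hIs i j).mul_const _)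
  have hint : IntegrableOn (fun u => u ^ (-1 - δ) * (8 * Real.sin (u / 2) ^ 3 * G u)) (Ioi 0) := by
    simp only [hexp]
    exact integrable_finsetSum _ fun i _ => integrable_finsetSum _ fun j _ => hI2 i j
  have hval : ∫ u in Ioi (0 : ℝ), u ^ (-1 - δ) * (8 * Real.sin (u / 2) ^ 3 * G u)
      = ∑ i, ∑ j, (sinInt δ * (D i j + D j i) * (x i * x j + y i * y j)
          - cosInt δ * (D i j - D j i) * (2 * (x i * y j))) := by
    simp only [hexp]
    rw [integral_finsetSum _ fun i _ => integrable_finsetSum _ fun j _ => hI2 i j]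
    refine Finset.sum_congr rfl fun i _ => ?_
    rw [integral_finsetSum _ fun j _ => hI2 i j]
    refine Finset.sum_congr rfl fun j _ => ?_
    rw [integral_sub ((hIc i j).mul_const _) ((hIs i j).mul_const _), integral_mul_const,
      integral_mul_const, hDt i j, sinInt_mul_thirdDiff_add hδ hδ1, cosInt_mul_thirdDiff_sub hδ hδ1]
  have hnonneg : 0 ≤ ∫ u in Ioi (0 : ℝ), u ^ (-1 - δ) * (8 * Real.sin (u / 2) ^ 3 * G u) := by
    refine integral_antiperiodic_mul_antitone_nonneg (p := 2 * Real.pi) (by positivity) hint ?_ ?_ ?_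
    · intro a ha b _ hab
      exact Real.rpow_le_rpow_of_nonpos ha hab (by linarith)
    · intro u
      have h1 : Real.sin ((u + 2 * Real.pi) / 2) = -Real.sin (u / 2) := by
        rw [show (u + 2 * Real.pi) / 2 = u / 2 + Real.pi by ring, Real.sin_add_pi]
      have h2 : G (u + 2 * Real.pi) = G u := by
        simp only [hG, mul_add, Real.sin_add_nat_mul_two_pi, Real.cos_add_nat_mul_two_pi]
      rw [h1, h2]
      ring
    · intro u hu
      have h1 : 0 ≤ Real.sin (u / 2) :=
        Real.sin_nonneg_of_nonneg_of_le_pi (by linarith [hu.1]) (by linarith [hu.2])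
      have h2 : 0 ≤ G u := by simp only [hG]; positivity
      positivity
  have hfinal : 2 * cosInt δ * (Real.tan (δ / 2 * Real.pi)
        * (x ⬝ᵥ toeplitzT δ n *ᵥ x + y ⬝ᵥ toeplitzT δ n *ᵥ y)
      - (x ⬝ᵥ toeplitzT δ n *ᵥ y - y ⬝ᵥ toeplitzT δ n *ᵥ x))
      = ∑ i, ∑ j, (sinInt δ * (D i j + D j i) * (x i * x j + y i * y j)
          - cosInt δ * (D i j - D j i) * (2 * (x i * y j))) := by
    have h3 : 2 * cosInt δ * (Real.tan (δ / 2 * Real.pi)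
        * (x ⬝ᵥ toeplitzT δ n *ᵥ x + y ⬝ᵥ toeplitzT δ n *ᵥ y)
      - (x ⬝ᵥ toeplitzT δ n *ᵥ y - y ⬝ᵥ toeplitzT δ n *ᵥ x))
      = (2 * sinInt δ) * (x ⬝ᵥ toeplitzT δ n *ᵥ x) + (2 * sinInt δ) * (y ⬝ᵥ toeplitzT δ n *ᵥ y)
        - (2 * cosInt δ) * (x ⬝ᵥ toeplitzT δ n *ᵥ y)
        + (2 * cosInt δ) * (y ⬝ᵥ toeplitzT δ n *ᵥ x) := by
      rw [ht]; field_simp; ring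
    rw [h3, hquad x, hquad y, hform x y, hform y x, hswap y x]
    simp only [Finset.mul_sum, ← Finset.sum_add_distrib, ← Finset.sum_sub_distrib]
    exact Finset.sum_congr rfl fun i _ => Finset.sum_congr rfl fun j _ => by ring
  rw [← hval] at hfinal
  have := nonneg_of_mul_nonneg_right (hfinal ▸ hnonneg) (by positivity)
  exact sub_nonneg.1 this

end ToeplitzRange

/-! ### Diagonal dominance and the `τ` matrix -/

section TauMatrix

open Matrix

theorem dotProduct_mulVec_eq_sum {ι : Type*} [Fintype ι] (A : Matrix ι ι ℝ) (x y : ι → ℝ) :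
    x ⬝ᵥ A *ᵥ y = ∑ i, ∑ j, A i j * (x i * y j) := by
  simp only [dotProduct, mulVec, Finset.mul_sum]
  exact Finset.sum_congr rfl fun i _ => Finset.sum_congr rfl fun j _ => by ring

/-- A symmetric diagonally dominant matrix is positive semidefinite. The off-diagonal entries are
bounded by a symmetric matrix `R`, of which the diagonal does not count. -/
theorem posSemidef_of_diagonally_dominant {ι : Type*} [Fintype ι] [DecidableEq ι]
    {A R : Matrix ι ι ℝ} (hA : A.transpose = A) (hR : ∀ i j, R i j = R j i)
    (hAR : ∀ i j, i ≠ j → |A i j| ≤ R i j)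
    (hdom : ∀ i, (∑ j, if i = j then 0 else R i j) ≤ A i i) : A.PosSemidef := by
  refine PosSemidef.of_dotProduct_mulVec_nonneg (by
    rw [IsHermitian, conjTranspose_eq_transpose_of_trivial, hA]) fun x => ?_
  rw [star_trivial, dotProduct_mulVec_eq_sum]
  set Q : ι → ι → ℝ := fun i j => if i = j then 0 else R i j with hQ
  have hQs : ∀ i j, Q i j = Q j i := by
    intro i j
    simp only [hQ, hR i j, eq_comm]
  have hterm : ∀ i j, (if i = j then A i i * x i ^ 2 else 0)
      - (Q i j * x i ^ 2 / 2 + Q i j * x j ^ 2 / 2) ≤ A i j * (x i * x j) := by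
    intro i j
    by_cases h : i = j
    · subst h
      simp only [hQ, if_true]
      nlinarith
    · simp only [hQ, if_neg h]
      have h1 := abs_le.1 (hAR i j h)
      nlinarith [mul_nonneg (sub_nonneg.2 h1.2) (sq_nonneg (x i - x j)),
        mul_nonneg (neg_le_iff_add_nonneg.1 h1.1) (sq_nonneg (x i + x j))]
  have hswap : ∑ i, ∑ j, Q i j * x j ^ 2 / 2 = ∑ i, ∑ j, Q i j * x i ^ 2 / 2 := by
    rw [Finset.sum_comm]
    exact Finset.sum_congr rfl fun i _ => Finset.sum_congr rfl fun j _ => by rw [hQs]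
  calc (0 : ℝ) ≤ ∑ i, (A i i - ∑ j, Q i j) * x i ^ 2 :=
        Finset.sum_nonneg fun i _ => mul_nonneg (sub_nonneg.2 (hdom i)) (sq_nonneg _)
    _ = ∑ i, ∑ j, ((if i = j then A i i * x i ^ 2 else 0)
          - (Q i j * x i ^ 2 / 2 + Q i j * x j ^ 2 / 2)) := by
        simp only [Finset.sum_sub_distrib, Finset.sum_add_distrib]
        rw [hswap, ← Finset.sum_add_distrib, ← Finset.sum_sub_distrib]
        refine Finset.sum_congr rfl fun i _ => ?_
        rw [Finset.sum_ite_eq, if_pos (Finset.mem_univ i), ← Finset.sum_add_distrib, sub_mul,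
          Finset.sum_mul]
        congr 1
        exact Finset.sum_congr rfl fun j _ => by ring
    _ ≤ _ := Finset.sum_le_sum fun i _ => Finset.sum_le_sum fun j _ => hterm i j

/-- The mass matrix has no eigenvalue below `1/2`. -/
theorem posSemidef_massA_sub (n : ℕ) : (massA n - (1 / 2 : ℝ) • 1).PosSemidef := by
  refine posSemidef_of_diagonally_dominant
    (R := of fun i j => (if (i : ℕ) + 1 = j then 1 / 8 else 0)
      + (if (j : ℕ) + 1 = i then 1 / 8 else 0)) ?_ ?_ ?_ ?_
  · ext i j
    simp only [transpose_apply, Matrix.sub_apply, Matrix.smul_apply, massA, of_apply, one_apply,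
      eq_comm (a := j) (b := i), or_comm (a := (j : ℕ) + 1 = i)]
  · intro i j
    simp only [of_apply]
    exact add_comm _ _
  · intro i j h
    simp only [Matrix.sub_apply, Matrix.smul_apply, massA, of_apply, one_apply, if_neg h]
    split_ifs with h1 h2 h3 h3 <;> first | omega | norm_num
  · intro i
    have hcard : ∀ p : Fin n → Prop, [DecidablePred p] → (∀ a b, p a → p b → a = b) →
        ∑ j, (if p j then (1 / 8 : ℝ) else 0) ≤ 1 / 8 := by
      intro p _ hp
      rw [← Finset.sum_filter, Finset.sum_const, nsmul_eq_mul]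
      have : (Finset.univ.filter p).card ≤ 1 := Finset.card_le_one.2 fun a ha b hb =>
        hp a b (Finset.mem_filter.1 ha).2 (Finset.mem_filter.1 hb).2
      have : ((Finset.univ.filter p).card : ℝ) ≤ 1 := by exact_mod_cast this
      linarith
    have h1 := hcard (fun j => (i : ℕ) + 1 = j) fun a b ha hb => Fin.ext (by omega)
    have h2 := hcard (fun j => (j : ℕ) + 1 = i) fun a b ha hb => Fin.ext (by omega)
    have h3 : (∑ j : Fin n, if i = j then (0 : ℝ) else
        ((if (i : ℕ) + 1 = j then 1 / 8 else 0) + (if (j : ℕ) + 1 = i then 1 / 8 else 0)))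
        ≤ ∑ j : Fin n, ((if (i : ℕ) + 1 = j then (1 / 8 : ℝ) else 0)
          + (if (j : ℕ) + 1 = i then 1 / 8 else 0)) := by
      refine Finset.sum_le_sum fun j _ => ?_
      split_ifs <;> norm_num
    rw [Finset.sum_add_distrib] at h3
    simp only [of_apply, Matrix.sub_apply, Matrix.smul_apply, massA, one_apply, if_true,
      smul_eq_mul]
    linarith

theorem posDef_massA (n : ℕ) : (massA n).PosDef := by
  have h := PosDef.posSemidef_add (posSemidef_massA_sub n)
    (PosDef.one.smul (by norm_num : (0 : ℝ) < 1 / 2))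
  rwa [sub_add_cancel] at h

/-- The symmetric Toeplitz matrix with first column `t`; `(i - j) + (j - i)` is `|i - j|` in `ℕ`. -/
def symToeplitz (t : ℕ → ℝ) (n : ℕ) : Matrix (Fin n) (Fin n) ℝ :=
  of fun i j => t (((i : ℕ) - j) + ((j : ℕ) - i))

theorem firstCol_symToeplitz (t : ℕ → ℝ) (n l : ℕ) :
    firstCol (symToeplitz t n) l = if l < n then t l else 0 := by
  unfold firstCol
  split_ifs with h
  · simp [symToeplitz]
  · rfl

section HankelCorrection

variable {v : ℕ → ℝ} {n : ℕ}

/-- The lower half of a row of the Toeplitz matrix and one of the two summands of the Hankel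
matrix together use every coefficient at most once. -/
theorem sum_lower_add_hankel_le (hv : ∀ l, 0 ≤ v (l + 1)) (hv0 : ∀ l, n ≤ l → v l = 0) {i : ℕ}
    (hi : i < n) :
    ∑ j ∈ Finset.range n, ((if j < i then v (i - j) else 0) + v (i + j + 2))
      ≤ ∑ l ∈ Finset.range (n - 1), v (l + 1) := by
  have h1 : ∑ j ∈ Finset.range n, (if j < i then v (i - j) else 0)
      = ∑ l ∈ Finset.range i, v (l + 1) := by
    rw [← Finset.sum_filter, ← Finset.sum_range_reflect]
    refine Finset.sum_congr ?_ fun j hj => ?_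
    · ext j
      simp only [Finset.mem_filter, Finset.mem_range]
      omega
    · have := Finset.mem_range.1 hj
      congr 1
      omega
  have h2 : ∑ j ∈ Finset.range n, v (i + j + 2) ≤ ∑ j ∈ Finset.range (n + 1), v (i + j + 1) := by
    rw [Finset.sum_range_succ']
    have : ∑ j ∈ Finset.range n, v (i + j + 2) = ∑ j ∈ Finset.range n, v (i + (j + 1) + 1) := rfl
    rw [this]
    linarith [hv (i + 0)]
  have h3 : ∑ l ∈ Finset.range i, v (l + 1) + ∑ j ∈ Finset.range (n + 1), v (i + j + 1)
      = ∑ l ∈ Finset.range (n - 1), v (l + 1) := by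
    rw [← Finset.sum_range_add (fun l => v (l + 1)) i (n + 1)]
    refine (Finset.sum_subset (Finset.range_subset_range.2 (by omega)) fun l _ hl => ?_).symm
    rw [Finset.mem_range, not_lt] at hl
    exact hv0 _ (by omega)
  rw [Finset.sum_add_distrib, h1]
  linarith

theorem sum_row_add_hankel_le (hv : ∀ l, 0 ≤ v (l + 1)) (hv0 : ∀ l, n ≤ l → v l = 0) (i : Fin n) :
    ∑ j : Fin n, ((if i = j then 0 else v (((i : ℕ) - j) + ((j : ℕ) - i)))
        + (v ((i : ℕ) + j + 2) + v (2 * n - ((i : ℕ) + j))))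
      ≤ 2 * ∑ l ∈ Finset.range (n - 1), v (l + 1) := by
  have h1 := sum_lower_add_hankel_le hv hv0 i.isLt
  have h2 := sum_lower_add_hankel_le hv hv0 (i := n - 1 - i) (by omega)
  rw [← Finset.sum_range_reflect] at h2
  refine le_trans (le_of_eq ?_) ((add_le_add h1 h2).trans_eq (two_mul _).symm)
  rw [← Finset.sum_add_distrib, Finset.sum_range]
  refine Finset.sum_congr rfl fun j _ => ?_
  have hj := j.isLt
  have hi := i.isLt
  have e1 : n - 1 - (i : ℕ) + (n - 1 - j) + 2 = 2 * n - ((i : ℕ) + j) := by omega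
  rw [e1]
  rcases lt_trichotomy (i : ℕ) j with h | h | h
  · rw [if_neg (fun hij => by rw [hij] at h; exact lt_irrefl _ h), if_neg (by omega),
      if_pos (by omega)]
    have e2 : n - 1 - (i : ℕ) - (n - 1 - j) = ((i : ℕ) - j) + ((j : ℕ) - i) := by omega
    rw [e2]
    ring
  · rw [if_pos (Fin.ext h), if_neg (by omega), if_neg (by omega)]
    ring
  · rw [if_neg (fun hij => by rw [hij] at h; exact lt_irrefl _ h), if_pos (by omega),
      if_neg (by omega)]
    have e2 : (i : ℕ) - j = ((i : ℕ) - j) + ((j : ℕ) - i) := by omega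
    rw [← e2]
    ring

/-- At most one of the two summands of a Hankel entry is nonzero, and its index exceeds that of
the Toeplitz entry in the same place. -/
theorem hankel_le (hv0 : ∀ l, n ≤ l → v l = 0)
    (hmono : ∀ k l, k ≤ l → v (l + 1) ≤ v (k + 1)) {i j : Fin n} (hij : i ≠ j) :
    v ((i : ℕ) + j + 2) + v (2 * n - ((i : ℕ) + j)) ≤ v (((i : ℕ) - j) + ((j : ℕ) - i)) := by
  have hi := i.isLt
  have hj := j.isLt
  have hne : (i : ℕ) ≠ j := fun h => hij (Fin.ext h)
  have hanti : ∀ k l, 1 ≤ k → k ≤ l → v l ≤ v k := by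
    intro k l hk hkl
    have := hmono (k - 1) (l - 1) (by omega)
    rwa [Nat.sub_add_cancel hk, Nat.sub_add_cancel (hk.trans hkl)] at this
  by_cases h : n ≤ (i : ℕ) + j + 2
  · rw [hv0 _ h, zero_add]
    exact hanti _ _ (by omega) (by omega)
  · rw [hv0 (2 * n - ((i : ℕ) + j)) (by omega), add_zero]
    exact hanti _ _ (by omega) (by omega)

end HankelCorrection

/-- The `τ` matrix of a diagonally dominant symmetric Toeplitz matrix with increasing nonpositive
off-diagonal coefficients is spectrally equivalent to that matrix, with constants `1/2` and `3/2`: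
with `H = C - τ(C)`, both `C + H` and `C - 3 H` are diagonally dominant. -/
theorem tauMatrix_symToeplitz_equiv {t : ℕ → ℝ} (hmono : Monotone fun k => t (k + 1))
    (hneg : ∀ k, t (k + 1) ≤ 0)
    (hdom : ∀ k, 0 ≤ t 0 + 2 * ∑ l ∈ Finset.range k, t (l + 1)) (n : ℕ) :
    (symToeplitz t n - (1 / 2 : ℝ) • tauMatrix (symToeplitz t n)).PosSemidef ∧
      ((3 / 2 : ℝ) • tauMatrix (symToeplitz t n) - symToeplitz t n).PosSemidef := by
  set v : ℕ → ℝ := fun l => if l < n then -t l else 0 with hv_def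
  have hv : ∀ l, 0 ≤ v (l + 1) := by
    intro l
    simp only [hv_def]
    split_ifs
    · linarith [hneg l]
    · exact le_rfl
  have hv0 : ∀ l, n ≤ l → v l = 0 := fun l hl => if_neg (not_lt.2 hl)
  have hvmono : ∀ k l, k ≤ l → v (l + 1) ≤ v (k + 1) := by
    intro k l hkl
    by_cases h : l + 1 < n
    · simp only [hv_def]
      rw [if_pos h, if_pos (by omega)]
      linarith [hmono hkl]
    · rw [hv0 _ (not_lt.1 h)]
      exact hv k
  set h : Fin n → Fin n → ℝ := fun i j => v ((i : ℕ) + j + 2) + v (2 * n - ((i : ℕ) + j)) with hh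
  have hh_nonneg : ∀ i j, 0 ≤ h i j := by
    intro i j
    have e : 2 * n - ((i : ℕ) + j) = 2 * n - ((i : ℕ) + j) - 1 + 1 := by omega
    simp only [hh]
    rw [e]
    exact add_nonneg (hv _) (hv _)
  have hh_symm : ∀ i j, h i j = h j i := by
    intro i j
    simp only [hh, add_comm (i : ℕ)]
  have htau : ∀ i j, tauMatrix (symToeplitz t n) i j = symToeplitz t n i j + h i j := by
    intro i j
    simp only [tauMatrix, of_apply, firstCol_symToeplitz, hh, hv_def]
    split_ifs <;> ring
  have hCsymm : ∀ i j, symToeplitz t n i j = symToeplitz t n j i := by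
    intro i j
    simp only [symToeplitz, of_apply, add_comm]
  have hCoff : ∀ i j : Fin n, i ≠ j →
      symToeplitz t n i j = -v (((i : ℕ) - j) + ((j : ℕ) - i)) := by
    intro i j hij
    simp only [symToeplitz, of_apply, hv_def]
    rw [if_pos (by omega), neg_neg]
  have hCdiag : ∀ i : Fin n, symToeplitz t n i i = t 0 := by
    intro i
    simp [symToeplitz]
  have hoff : ∀ i j : Fin n, i ≠ j → h i j ≤ -symToeplitz t n i j := by
    intro i j hij
    rw [hCoff i j hij, neg_neg]
    exact hankel_le hv0 hvmono hij
  have hrow : ∀ i : Fin n, (∑ j, if i = j then 0 else -symToeplitz t n i j + h i j) + h i i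
      ≤ t 0 := by
    intro i
    have h1 := sum_row_add_hankel_le hv hv0 i
    have h2 : ∑ l ∈ Finset.range (n - 1), v (l + 1)
        = -∑ l ∈ Finset.range (n - 1), t (l + 1) := by
      rw [← Finset.sum_neg_distrib]
      refine Finset.sum_congr rfl fun l hl => ?_
      have := Finset.mem_range.1 hl
      simp only [hv_def]
      rw [if_pos (by omega)]
    have h3 : (∑ j, if i = j then 0 else -symToeplitz t n i j + h i j) + h i i
        = ∑ j : Fin n, ((if i = j then 0 else v (((i : ℕ) - j) + ((j : ℕ) - i)))
          + (v ((i : ℕ) + j + 2) + v (2 * n - ((i : ℕ) + j)))) := by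
      have h4 : h i i = ∑ j, if i = j then h i j else 0 := by
        rw [Finset.sum_ite_eq, if_pos (Finset.mem_univ i)]
      rw [h4, ← Finset.sum_add_distrib]
      refine Finset.sum_congr rfl fun j _ => ?_
      split_ifs with hij
      · rfl
      · rw [hCoff i j hij, neg_neg, add_zero]
    linarith [hdom (n - 1)]
  -- the two matrices are halves of `C + H` and `C - 3 H`, where `H` has the entries `-h i j`
  constructor
  · have key : (of fun i j => symToeplitz t n i j - h i j : Matrix (Fin n) (Fin n) ℝ).PosSemidef := by
      refine posSemidef_of_diagonally_dominant (R := of fun i j => -symToeplitz t n i j + h i j)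
        ?_ ?_ ?_ ?_
      · ext i j
        simp only [transpose_apply, of_apply, hCsymm i j, hh_symm i j]
      · intro i j
        simp only [of_apply, hCsymm i j, hh_symm i j]
      · intro i j hij
        have := hoff i j hij
        have := hh_nonneg i j
        simp only [of_apply]
        rw [abs_of_nonpos (by linarith)]
        linarith
      · intro i
        have := hrow i
        simp only [of_apply, hCdiag]
        linarith
    have e : symToeplitz t n - (1 / 2 : ℝ) • tauMatrix (symToeplitz t n)
        = (1 / 2 : ℝ) • of fun i j => symToeplitz t n i j - h i j := by
      ext i j
      simp only [Matrix.sub_apply, Matrix.smul_apply, of_apply, htau, smul_eq_mul]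
      ring
    rw [e]
    exact key.smul (by norm_num)
  · have key : (of fun i j => symToeplitz t n i j + 3 * h i j :
        Matrix (Fin n) (Fin n) ℝ).PosSemidef := by
      refine posSemidef_of_diagonally_dominant (R := of fun i j => -symToeplitz t n i j + h i j)
        ?_ ?_ ?_ ?_
      · ext i j
        simp only [transpose_apply, of_apply, hCsymm i j, hh_symm i j]
      · intro i j
        simp only [of_apply, hCsymm i j, hh_symm i j]
      · intro i j hij
        have := hoff i j hij
        have := hh_nonneg i j
        simp only [of_apply]
        rw [abs_le]
        constructor <;> linarith
      · intro i
        have := hrow i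
        have := hh_nonneg i i
        simp only [of_apply, hCdiag]
        linarith
    have e : (3 / 2 : ℝ) • tauMatrix (symToeplitz t n) - symToeplitz t n
        = (1 / 2 : ℝ) • of fun i j => symToeplitz t n i j + 3 * h i j := by
      ext i j
      simp only [Matrix.sub_apply, Matrix.smul_apply, of_apply, htau, smul_eq_mul]
      ring
    rw [e]
    exact key.smul (by norm_num)

theorem symPart_stiffB (δ kp km : ℝ) (n : ℕ) :
    symPart (stiffB δ kp km n) = symToeplitz (fun l => (kp + km) * symCoef δ l) n := by
  have hT : ∀ i j : Fin n, toeplitzT δ n i j + toeplitzT δ n j i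
      = 2 * symCoef δ (((i : ℕ) - j) + ((j : ℕ) - i)) := by
    have hle : ∀ i j : Fin n, (i : ℕ) ≤ j → toeplitzT δ n i j + toeplitzT δ n j i
        = 2 * symCoef δ (((i : ℕ) - j) + ((j : ℕ) - i)) := by
      intro i j hij
      obtain ⟨d, hd⟩ := Nat.exists_eq_add_of_le hij
      simp only [toeplitzT, of_apply, hd]
      rcases d with _ | _ | d
      · simp [symCoef]
        ring
      · rw [if_pos (by omega), if_pos (by omega),
          show (i : ℕ) + 1 - ((i : ℕ) + (0 + 1)) = 0 by omega,
          show (i : ℕ) + (0 + 1) + 1 - (i : ℕ) = 2 by omega,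
          show (i : ℕ) - ((i : ℕ) + (0 + 1)) + ((i : ℕ) + (0 + 1) - i) = 1 by omega]
        simp only [symCoef]
        ring
      · rw [if_neg (by omega), if_pos (by omega),
          show (i : ℕ) + (d + 1 + 1) + 1 - (i : ℕ) = d + 3 by omega,
          show (i : ℕ) - ((i : ℕ) + (d + 1 + 1)) + ((i : ℕ) + (d + 1 + 1) - i) = d + 2 by omega]
        simp only [symCoef]
        ring
    intro i j
    rcases le_total (i : ℕ) j with h | h
    · exact hle i j h
    · rw [add_comm, hle j i h, add_comm ((j : ℕ) - i)]
  ext i j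
  have := hT i j
  simp only [symPart, stiffB, symToeplitz, Matrix.smul_apply, Matrix.add_apply, transpose_apply,
    of_apply, smul_eq_mul]
  linear_combination (kp + km) / 2 * this

/-- The `τ` matrices of the symmetric parts of the stiffness matrices satisfy
`τ / 2 ≤ symPart B ≤ 3 τ / 2`. -/
theorem tauMatrix_stiffB_equiv {δ kp km : ℝ} (hδ : 0 < δ) (hδ1 : δ < 1) (hk : 0 ≤ kp + km)
    (n : ℕ) :
    (symPart (stiffB δ kp km n)
        - (1 / 2 : ℝ) • tauMatrix (symPart (stiffB δ kp km n))).PosSemidef ∧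
      ((3 / 2 : ℝ) • tauMatrix (symPart (stiffB δ kp km n))
        - symPart (stiffB δ kp km n)).PosSemidef := by
  rw [symPart_stiffB]
  refine tauMatrix_symToeplitz_equiv ?_ ?_ ?_ n
  · exact fun a b hab => mul_le_mul_of_nonneg_left (symCoef_monotone hδ hδ1 hab) hk
  · exact fun k => mul_nonpos_of_nonneg_of_nonpos hk (symCoef_succ_nonpos hδ hδ1 k)
  · intro k
    rw [← Finset.mul_sum]
    nlinarith [mul_nonneg hk (symCoef_zero_add_sum_nonneg hδ hδ1 k)]

/-- The numerical range of the stiffness matrix lies in a sector. -/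
theorem stiffB_sector {δ kp km κ : ℝ} (hδ : 0 < δ) (hδ1 : δ < 1) (hk : 0 < kp + km)
    (hκ : Real.tan (δ / 2 * Real.pi) * (|kp - km| / (kp + km)) ≤ κ) {n : ℕ} (x y : Fin n → ℝ) :
    x ⬝ᵥ stiffB δ kp km n *ᵥ y - y ⬝ᵥ stiffB δ kp km n *ᵥ x
      ≤ κ * (x ⬝ᵥ stiffB δ kp km n *ᵥ x + y ⬝ᵥ stiffB δ kp km n *ᵥ y) := by
  set T := toeplitzT δ n with hT
  have hform : ∀ p q : Fin n → ℝ, p ⬝ᵥ stiffB δ kp km n *ᵥ q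
      = kp * (p ⬝ᵥ T *ᵥ q) + km * (q ⬝ᵥ T *ᵥ p) := by
    intro p q
    rw [stiffB, add_mulVec, smul_mulVec, smul_mulVec, dotProduct_add, dotProduct_smul,
      dotProduct_smul, smul_eq_mul, smul_eq_mul, mulVec_transpose, dotProduct_comm p (q ᵥ* T),
      ← dotProduct_mulVec]
  have h1 := toeplitzT_sector hδ hδ1 x y
  have h2 := toeplitzT_sector hδ hδ1 y x
  rw [← hT] at h1 h2
  obtain ⟨hs, hc, ht⟩ := sinInt_pos_and_cosInt_pos_and_tan hδ hδ1
  have htan : 0 < Real.tan (δ / 2 * Real.pi) := ht ▸ div_pos hs hc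
  set τ := Real.tan (δ / 2 * Real.pi)
  set S := x ⬝ᵥ T *ᵥ x + y ⬝ᵥ T *ᵥ y with hS
  set W := x ⬝ᵥ T *ᵥ y - y ⬝ᵥ T *ᵥ x with hW
  have h2' : -W ≤ τ * S := by
    rw [hS, add_comm, hW, neg_sub]
    exact h2
  have hS0 : 0 ≤ S := by
    have : 0 ≤ τ * S := by linarith
    exact nonneg_of_mul_nonneg_right this htan
  have hκ' : τ * |kp - km| ≤ κ * (kp + km) := by
    rw [← mul_div_assoc, div_le_iff₀ hk] at hκ
    exact hκ
  have hW' : (kp - km) * W ≤ |kp - km| * (τ * S) := by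
    calc (kp - km) * W ≤ |(kp - km) * W| := le_abs_self _
      _ = |kp - km| * |W| := abs_mul _ _
      _ ≤ |kp - km| * (τ * S) :=
        mul_le_mul_of_nonneg_left (abs_le.2 ⟨by linarith, h1⟩) (abs_nonneg _)
  have h3 := mul_le_mul_of_nonneg_right hκ' hS0
  rw [hform, hform, hform, hform]
  have e1 : kp * (x ⬝ᵥ T *ᵥ y) + km * (y ⬝ᵥ T *ᵥ x) - (kp * (y ⬝ᵥ T *ᵥ x) + km * (x ⬝ᵥ T *ᵥ y))
      = (kp - km) * W := by rw [hW]; ring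
  have e2 : κ * (kp * (x ⬝ᵥ T *ᵥ x) + km * (x ⬝ᵥ T *ᵥ x) + (kp * (y ⬝ᵥ T *ᵥ y)
      + km * (y ⬝ᵥ T *ᵥ y))) = κ * (kp + km) * S := by rw [hS]; ring
  rw [e1, e2]
  linarith

end TauMatrix

/-! ### Kronecker sums -/

section KroneckerSums

open Matrix
open scoped ComplexOrder

section SectorMatrix

variable {ι : Type*}

/-- The Hermitian matrix `κ (A + Aᵀ) + i (A - Aᵀ)`. It is positive semidefinite exactly when
the bilinear form of `A` satisfies a sector condition with constant `κ`. -/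
def sectorMatrix (κ : ℝ) (A : Matrix ι ι ℝ) : Matrix ι ι ℂ :=
  of fun i j => ((κ * (A i j + A j i) : ℝ) : ℂ) + Complex.I * ((A i j - A j i : ℝ) : ℂ)

theorem sectorMatrix_isHermitian (κ : ℝ) (A : Matrix ι ι ℝ) : (sectorMatrix κ A).IsHermitian := by
  ext i j
  simp only [conjTranspose_apply, sectorMatrix, of_apply, Complex.star_def, map_add, map_mul,
    Complex.conj_ofReal, Complex.conj_I]
  push_cast
  ring

theorem re_star_dotProduct_sectorMatrix [Fintype ι] (κ : ℝ) (A : Matrix ι ι ℝ) (x y : ι → ℝ) :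
    (star (fun i => (x i : ℂ) + Complex.I * y i)
        ⬝ᵥ sectorMatrix κ A *ᵥ fun i => (x i : ℂ) + Complex.I * y i).re
      = 2 * (κ * (x ⬝ᵥ A *ᵥ x + y ⬝ᵥ A *ᵥ y) - (x ⬝ᵥ A *ᵥ y - y ⬝ᵥ A *ᵥ x)) := by
  have hswap : ∀ p q : ι → ℝ,
      ∑ i, ∑ j, A j i * (p i * q j) = ∑ i, ∑ j, A i j * (q i * p j) := by
    intro p q
    rw [Finset.sum_comm]
    exact Finset.sum_congr rfl fun i _ => Finset.sum_congr rfl fun j _ => by ring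
  have hterm : ∀ i j, (star ((x i : ℂ) + Complex.I * y i)
        * (sectorMatrix κ A i j * ((x j : ℂ) + Complex.I * y j))).re
      = κ * (A i j * (x i * x j)) + κ * (A j i * (x i * x j)) + κ * (A i j * (y i * y j))
        + κ * (A j i * (y i * y j)) - A i j * (x i * y j) + A j i * (x i * y j)
        + A i j * (y i * x j) - A j i * (y i * x j) := by
    intro i j
    simp only [sectorMatrix, of_apply, Complex.star_def, map_add, map_mul, Complex.conj_ofReal,
      Complex.conj_I, Complex.mul_re, Complex.add_re, Complex.add_im, Complex.mul_im,
      Complex.ofReal_re, Complex.ofReal_im, Complex.I_re, Complex.I_im, Complex.neg_re,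
      Complex.neg_im]
    ring
  simp only [dotProduct, mulVec, Finset.mul_sum, Complex.re_sum, Pi.star_apply, hterm,
    Finset.sum_add_distrib, Finset.sum_sub_distrib]
  simp only [← Finset.mul_sum, hswap]
  have e : ∀ p q : ι → ℝ, ∑ i, p i * ∑ j, A i j * q j = ∑ i, ∑ j, A i j * (p i * q j) :=
    fun p q => dotProduct_mulVec_eq_sum A p q
  simp only [e]
  ring

theorem sectorMatrix_posSemidef_iff [Fintype ι] {κ : ℝ} {A : Matrix ι ι ℝ} :
    (sectorMatrix κ A).PosSemidef ↔ ∀ x y : ι → ℝ,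
      x ⬝ᵥ A *ᵥ y - y ⬝ᵥ A *ᵥ x ≤ κ * (x ⬝ᵥ A *ᵥ x + y ⬝ᵥ A *ᵥ y) := by
  constructor
  · intro h x y
    have h1 := h.dotProduct_mulVec_nonneg fun i => (x i : ℂ) + Complex.I * y i
    have h2 := (Complex.nonneg_iff.1 h1).1
    rw [re_star_dotProduct_sectorMatrix] at h2
    linarith
  · intro h
    refine PosSemidef.of_dotProduct_mulVec_nonneg (sectorMatrix_isHermitian κ A) fun z => ?_
    have hz : z = fun i => ((z i).re : ℂ) + Complex.I * (z i).im := by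
      funext i
      rw [mul_comm]
      exact (Complex.re_add_im (z i)).symm
    refine Complex.nonneg_iff.2 ⟨?_, ?_⟩
    · rw [hz, re_star_dotProduct_sectorMatrix]
      linarith [h (fun i => (z i).re) fun i => (z i).im]
    · exact ((sectorMatrix_isHermitian κ A).im_star_dotProduct_mulVec_self z).symm

theorem posSemidef_map_ofReal [Finite ι] {A : Matrix ι ι ℝ} (hA : A.PosSemidef) :
    (A.map ((↑) : ℝ → ℂ)).PosSemidef := by
  have := Fintype.ofFinite ι
  have hsymm : ∀ i j, A j i = A i j := fun i j => by simpa using hA.1.apply i j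
  have h : A.map ((↑) : ℝ → ℂ) = sectorMatrix (1 / 2) A := by
    ext i j
    simp only [map_apply, sectorMatrix, of_apply, hsymm i j]
    push_cast
    ring
  rw [h]
  refine sectorMatrix_posSemidef_iff.2 fun x y => ?_
  have e : x ⬝ᵥ A *ᵥ y = y ⬝ᵥ A *ᵥ x := by
    rw [dotProduct_mulVec, ← mulVec_transpose, dotProduct_comm,
      show A.transpose = A from by ext i j; exact hsymm i j]
  have hx := hA.dotProduct_mulVec_nonneg x
  have hy := hA.dotProduct_mulVec_nonneg y
  rw [star_trivial] at hx hy
  rw [e]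
  linarith

end SectorMatrix

theorem massA_symm (n : ℕ) (i j : Fin n) : massA n j i = massA n i j := by
  simpa using (posDef_massA n).1.apply i j

section ThreeLevel

variable {n : Fin 3 → ℕ} {η : Fin 3 → ℝ} {B C : (i : Fin 3) → Matrix (Fin (n i)) (Fin (n i)) ℝ}

theorem threeLevel_sub_smul (n : Fin 3 → ℕ) (η : Fin 3 → ℝ)
    (B C : (i : Fin 3) → Matrix (Fin (n i)) (Fin (n i)) ℝ) (c d : ℝ) :
    c • threeLevel n η B - d • threeLevel n η C
      = (c - d) • (massA (n 2) ⊗ₖ massA (n 1) ⊗ₖ massA (n 0))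
        + η 0 • (massA (n 2) ⊗ₖ massA (n 1) ⊗ₖ (c • B 0 - d • C 0))
        + η 1 • (massA (n 2) ⊗ₖ (c • B 1 - d • C 1) ⊗ₖ massA (n 0))
        + η 2 • ((c • B 2 - d • C 2) ⊗ₖ massA (n 1) ⊗ₖ massA (n 0)) := by
  ext i j
  simp only [threeLevel, Matrix.sub_apply, Matrix.smul_apply, Matrix.add_apply,
    kroneckerMap_apply, smul_eq_mul]
  ring

theorem posSemidef_threeLevel_sub (hη : ∀ i, 0 ≤ η i) {c d : ℝ} (hcd : d ≤ c)
    (h : ∀ i, (c • B i - d • C i).PosSemidef) :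
    (c • threeLevel n η B - d • threeLevel n η C).PosSemidef := by
  have hM : ∀ k, (massA k).PosSemidef := fun k => (posDef_massA k).posSemidef
  rw [threeLevel_sub_smul]
  exact (((((hM _).kronecker (hM _)).kronecker (hM _)).smul (sub_nonneg.2 hcd)).add
    ((((hM _).kronecker (hM _)).kronecker (h 0)).smul (hη 0))).add
    ((((hM _).kronecker (h 1)).kronecker (hM _)).smul (hη 1)) |>.add
    ((((h 2).kronecker (hM _)).kronecker (hM _)).smul (hη 2))

theorem posDef_threeLevel (hη : ∀ i, 0 ≤ η i) (h : ∀ i, (C i).PosSemidef) :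
    (threeLevel n η C).PosDef := by
  have hM : ∀ k, (massA k).PosDef := posDef_massA
  have hS : ∀ k, (massA k).PosSemidef := fun k => (hM k).posSemidef
  exact (((((hM _).kronecker (hM _)).kronecker (hM _)).add_posSemidef
    ((((hS _).kronecker (hS _)).kronecker (h 0)).smul (hη 0))).add_posSemidef
    ((((hS _).kronecker (h 1)).kronecker (hS _)).smul (hη 1))).add_posSemidef
    ((((h 2).kronecker (hS _)).kronecker (hS _)).smul (hη 2))

theorem symPart_threeLevel :
    symPart (threeLevel n η B) = threeLevel n η fun i => symPart (B i) := by
  ext i j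
  simp only [symPart, threeLevel, Matrix.smul_apply, Matrix.add_apply, transpose_apply,
    kroneckerMap_apply, smul_eq_mul, massA_symm _ (i.1.1) (j.1.1), massA_symm _ (i.1.2) (j.1.2),
    massA_symm _ (i.2) (j.2)]
  ring

theorem sectorMatrix_threeLevel (n : Fin 3 → ℕ) (η : Fin 3 → ℝ)
    (B : (i : Fin 3) → Matrix (Fin (n i)) (Fin (n i)) ℝ) (κ : ℝ) :
    sectorMatrix κ (threeLevel n η B)
      = (2 * κ) • ((massA (n 2)).map ((↑) : ℝ → ℂ) ⊗ₖ (massA (n 1)).map ((↑) : ℝ → ℂ)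
          ⊗ₖ (massA (n 0)).map ((↑) : ℝ → ℂ))
        + η 0 • ((massA (n 2)).map ((↑) : ℝ → ℂ) ⊗ₖ (massA (n 1)).map ((↑) : ℝ → ℂ)
          ⊗ₖ sectorMatrix κ (B 0))
        + η 1 • ((massA (n 2)).map ((↑) : ℝ → ℂ) ⊗ₖ sectorMatrix κ (B 1)
          ⊗ₖ (massA (n 0)).map ((↑) : ℝ → ℂ))
        + η 2 • (sectorMatrix κ (B 2) ⊗ₖ (massA (n 1)).map ((↑) : ℝ → ℂ)
          ⊗ₖ (massA (n 0)).map ((↑) : ℝ → ℂ)) := by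
  ext i j
  simp only [sectorMatrix, threeLevel, Matrix.smul_apply, Matrix.add_apply, of_apply, map_apply,
    kroneckerMap_apply, smul_eq_mul, Complex.real_smul, massA_symm _ (i.1.1) (j.1.1),
    massA_symm _ (i.1.2) (j.1.2), massA_symm _ (i.2) (j.2)]
  push_cast
  ring

theorem threeLevel_sector {κ : ℝ} (hκ : 0 ≤ κ) (hη : ∀ i, 0 ≤ η i)
    (h : ∀ i, ∀ x y : Fin (n i) → ℝ,
      x ⬝ᵥ B i *ᵥ y - y ⬝ᵥ B i *ᵥ x ≤ κ * (x ⬝ᵥ B i *ᵥ x + y ⬝ᵥ B i *ᵥ y))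
    (x y : Grid n → ℝ) :
    x ⬝ᵥ threeLevel n η B *ᵥ y - y ⬝ᵥ threeLevel n η B *ᵥ x
      ≤ κ * (x ⬝ᵥ threeLevel n η B *ᵥ x + y ⬝ᵥ threeLevel n η B *ᵥ y) := by
  have hM : ∀ k, ((massA k).map ((↑) : ℝ → ℂ)).PosSemidef := fun k =>
    posSemidef_map_ofReal (posDef_massA k).posSemidef
  have hB : ∀ i, (sectorMatrix κ (B i)).PosSemidef := fun i => sectorMatrix_posSemidef_iff.2 (h i)
  refine sectorMatrix_posSemidef_iff.1 ?_ x y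
  rw [sectorMatrix_threeLevel]
  exact (((((hM _).kronecker (hM _)).kronecker (hM _)).smul (by positivity : 0 ≤ 2 * κ)).add
    ((((hM _).kronecker (hM _)).kronecker (hB 0)).smul (hη 0))).add
    ((((hM _).kronecker (hB 1)).kronecker (hM _)).smul (hη 1)) |>.add
    ((((hB 2).kronecker (hM _)).kronecker (hM _)).smul (hη 2))

end ThreeLevel

theorem dotProduct_symPart_mulVec {ι : Type*} [Fintype ι] (A : Matrix ι ι ℝ) (x y : ι → ℝ) :
    x ⬝ᵥ symPart A *ᵥ y = (x ⬝ᵥ A *ᵥ y + y ⬝ᵥ A *ᵥ x) / 2 := by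
  rw [symPart, smul_mulVec, add_mulVec, dotProduct_smul, dotProduct_add, mulVec_transpose,
    dotProduct_comm x (y ᵥ* A), ← dotProduct_mulVec, smul_eq_mul]
  ring

/-! ### The inverse square root -/

section InvSqrt

variable {ι : Type*} [Fintype ι]

theorem spectrum_pos_of_posDef [DecidableEq ι] {P : Matrix ι ι ℝ} (hP : P.PosDef) {x : ℝ}
    (hx : x ∈ spectrum ℝ P) : 0 < x := by
  have h1 := (posSemidef_iff_isHermitian_and_spectrum_nonneg.1 hP.posSemidef).2 hx
  refine lt_of_le_of_ne h1 fun h => ?_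
  rw [← h] at hx
  exact (spectrum.zero_mem_iff ℝ).1 hx hP.isUnit

theorem invSqrt_transpose [DecidableEq ι] (P : Matrix ι ι ℝ) : (invSqrt P).transpose = invSqrt P := by
  have h : IsSelfAdjoint (invSqrt P) := IsSelfAdjoint.cfc
  rw [← conjTranspose_eq_transpose_of_trivial]
  exact h

theorem invSqrt_mul_mul_invSqrt [DecidableEq ι] {P : Matrix ι ι ℝ} (hP : P.PosDef) :
    invSqrt P * P * invSqrt P = 1 := by
  have hsa : IsSelfAdjoint P := hP.1
  have hc : ContinuousOn (fun x : ℝ => x ^ (-(1 / 2) : ℝ)) (spectrum ℝ P) := fun x hx =>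
    (Real.continuousAt_rpow_const x _
      (Or.inl (spectrum_pos_of_posDef hP hx).ne')).continuousWithinAt
  have hid : ContinuousOn (id : ℝ → ℝ) (spectrum ℝ P) := continuousOn_id
  calc invSqrt P * P * invSqrt P
      = cfc (fun x : ℝ => x ^ (-(1 / 2) : ℝ)) P * cfc id P
        * cfc (fun x : ℝ => x ^ (-(1 / 2) : ℝ)) P := by rw [cfc_id ℝ P]; rfl
    _ = cfc (fun x : ℝ => x ^ (-(1 / 2) : ℝ) * id x * x ^ (-(1 / 2) : ℝ)) P := by
        rw [← cfc_mul _ _ P hc hid]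
        exact (cfc_mul (fun x : ℝ => x ^ (-(1 / 2) : ℝ) * id x) _ P (hc.mul hid) hc).symm
    _ = cfc (fun _ : ℝ => (1 : ℝ)) P := by
        refine cfc_congr fun x hx => ?_
        have hx0 := spectrum_pos_of_posDef hP hx
        have h1 : x ^ (-(1 / 2) : ℝ) * id x * x ^ (-(1 / 2) : ℝ)
            = x ^ (-(1 / 2) : ℝ) * x ^ (1 : ℝ) * x ^ (-(1 / 2) : ℝ) := by
          rw [Real.rpow_one, id]
        simp only [h1, ← Real.rpow_add hx0]
        norm_num
    _ = 1 := cfc_const_one ℝ P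

theorem dotProduct_conj_mulVec {G : Matrix ι ι ℝ} (hG : G.transpose = G) (A : Matrix ι ι ℝ)
    (x y : ι → ℝ) : x ⬝ᵥ (G * A * G) *ᵥ y = (G *ᵥ x) ⬝ᵥ A *ᵥ (G *ᵥ y) := by
  rw [Matrix.mul_assoc, ← mulVec_mulVec, dotProduct_mulVec, ← mulVec_transpose, hG, mulVec_mulVec]

end InvSqrt

end KroneckerSums

/-! ### Convergence of GMRES -/

section Convergence

open Matrix

section GMRESConvergence

variable {ι : Type*} [Fintype ι]

/-- With `H` and `S` the symmetric and the skew part of `Z`, and `u = H⁻¹ S r`, `w = r + u`, one has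
`Z r = H w`; here `r` and `u` are `H`-orthogonal, so `⟨w, H w⟩ ≤ (1 + κ²) ⟨r, H r⟩`, and
`‖H w‖² ≤ 3/2 ⟨w, H w⟩`. -/
theorem mulVec_dotProduct_self_le [DecidableEq ι] {Z : Matrix ι ι ℝ} {κ : ℝ} (hκ : 0 ≤ κ)
    (hlow : ∀ x : ι → ℝ, 1 / 2 * (x ⬝ᵥ x) ≤ x ⬝ᵥ Z *ᵥ x)
    (hup : ∀ x : ι → ℝ, x ⬝ᵥ Z *ᵥ x ≤ 3 / 2 * (x ⬝ᵥ x))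
    (hsec : ∀ x y : ι → ℝ,
      x ⬝ᵥ Z *ᵥ y - y ⬝ᵥ Z *ᵥ x ≤ κ * (x ⬝ᵥ Z *ᵥ x + y ⬝ᵥ Z *ᵥ y)) (r : ι → ℝ) :
    (Z *ᵥ r) ⬝ᵥ (Z *ᵥ r) ≤ 3 / 2 * (1 + κ ^ 2) * (r ⬝ᵥ Z *ᵥ r) := by
  set H := symPart Z with hH_def
  have hH : ∀ x y : ι → ℝ, x ⬝ᵥ H *ᵥ y = (x ⬝ᵥ Z *ᵥ y + y ⬝ᵥ Z *ᵥ x) / 2 :=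
    dotProduct_symPart_mulVec Z
  have hHself : ∀ x : ι → ℝ, x ⬝ᵥ H *ᵥ x = x ⬝ᵥ Z *ᵥ x := fun x => by rw [hH]; ring
  have hHcomm : ∀ x y : ι → ℝ, x ⬝ᵥ H *ᵥ y = y ⬝ᵥ H *ᵥ x := fun x y => by rw [hH, hH]; ring
  have hHpos : H.PosDef := by
    refine PosDef.of_dotProduct_mulVec_pos ?_ fun x hx => ?_
    · rw [IsHermitian, conjTranspose_eq_transpose_of_trivial, hH_def, symPart, transpose_smul,
        transpose_add, transpose_transpose, add_comm]
    · rw [star_trivial, hHself]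
      have h1 : 0 < x ⬝ᵥ x := by
        have := dotProduct_star_self_pos_iff.2 hx
        rwa [star_trivial] at this
      linarith [hlow x]
  have hdet : IsUnit H.det := (isUnit_iff_isUnit_det H).1 hHpos.isUnit
  set u := H⁻¹ *ᵥ (Z *ᵥ r - H *ᵥ r) with hu_def
  have hu : H *ᵥ u = Z *ᵥ r - H *ᵥ r := by
    rw [hu_def, mulVec_mulVec, mul_nonsing_inv _ hdet, one_mulVec]
  have hw : H *ᵥ (r + u) = Z *ᵥ r := by rw [mulVec_add, hu]; abel
  have hpu : ∀ p : ι → ℝ, p ⬝ᵥ H *ᵥ u = (p ⬝ᵥ Z *ᵥ r - r ⬝ᵥ Z *ᵥ p) / 2 := by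
    intro p
    rw [hu, dotProduct_sub, hH]
    ring
  have huu : u ⬝ᵥ H *ᵥ u ≤ κ ^ 2 * (r ⬝ᵥ Z *ᵥ r) := by
    have h1 := hpu u
    rcases hκ.eq_or_lt with h0 | h0
    · have h2 := hsec u r
      rw [← h0] at h2 ⊢
      linarith
    · have h2 := hsec u (κ • r)
      simp only [mulVec_smul, dotProduct_smul, smul_dotProduct, smul_eq_mul] at h2
      have h3 : κ * (2 * (u ⬝ᵥ H *ᵥ u)) ≤ κ * (u ⬝ᵥ H *ᵥ u + κ ^ 2 * (r ⬝ᵥ Z *ᵥ r)) := by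
        have := hHself u
        calc κ * (2 * (u ⬝ᵥ H *ᵥ u)) = κ * (u ⬝ᵥ Z *ᵥ r) - κ * (r ⬝ᵥ Z *ᵥ u) := by rw [h1]; ring
          _ ≤ κ * (u ⬝ᵥ Z *ᵥ u + κ * (κ * (r ⬝ᵥ Z *ᵥ r))) := h2
          _ = κ * (u ⬝ᵥ H *ᵥ u + κ ^ 2 * (r ⬝ᵥ Z *ᵥ r)) := by rw [this]; ring
      have := le_of_mul_le_mul_left h3 h0
      linarith
  have hru : r ⬝ᵥ H *ᵥ u = 0 := by rw [hpu]; ring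
  have hww : (r + u) ⬝ᵥ H *ᵥ (r + u) ≤ (1 + κ ^ 2) * (r ⬝ᵥ Z *ᵥ r) := by
    rw [mulVec_add, dotProduct_add, add_dotProduct, add_dotProduct, hHcomm u r, hru, hHself r]
    linarith
  set w := r + u
  set y := Z *ᵥ r with hy
  have hyw : y ⬝ᵥ H *ᵥ w = y ⬝ᵥ y := by rw [hw]
  -- `2` and `3` are, up to scaling, the optimal weights for `⟨y, H y⟩ ≤ 3/2 ‖y‖²`
  have hsq : 0 ≤ ((2 : ℝ) • y - (3 : ℝ) • w) ⬝ᵥ H *ᵥ ((2 : ℝ) • y - (3 : ℝ) • w) := by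
    have := hHpos.posSemidef.dotProduct_mulVec_nonneg ((2 : ℝ) • y - (3 : ℝ) • w)
    rwa [star_trivial] at this
  simp only [mulVec_sub, mulVec_smul, dotProduct_sub, sub_dotProduct, dotProduct_smul,
    smul_dotProduct, smul_eq_mul] at hsq
  rw [hHcomm w y, hyw] at hsq
  have h4 := hup y
  rw [← hHself] at h4
  linarith

theorem norm_sq_eq_dotProduct (x : EuclideanSpace ℝ ι) : ‖x‖ ^ 2 = x.ofLp ⬝ᵥ x.ofLp := by
  rw [← real_inner_self_eq_norm_sq, EuclideanSpace.inner_eq_star_dotProduct, star_trivial]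

variable [DecidableEq ι]

/-- One step of a stationary Richardson iteration contracts. -/
theorem exists_norm_sub_smul_le {Z : Matrix ι ι ℝ} {κ : ℝ} (hκ : 0 ≤ κ)
    (hlow : ∀ x : ι → ℝ, 1 / 2 * (x ⬝ᵥ x) ≤ x ⬝ᵥ Z *ᵥ x)
    (hup : ∀ x : ι → ℝ, x ⬝ᵥ Z *ᵥ x ≤ 3 / 2 * (x ⬝ᵥ x))
    (hsec : ∀ x y : ι → ℝ,
      x ⬝ᵥ Z *ᵥ y - y ⬝ᵥ Z *ᵥ x ≤ κ * (x ⬝ᵥ Z *ᵥ x + y ⬝ᵥ Z *ᵥ y)) :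
    ∃ α : ℝ, ∀ r : EuclideanSpace ℝ ι, ‖r - α • toEuclideanLin Z r‖ ^ 2
      ≤ (2 + 3 * κ ^ 2) / (3 + 3 * κ ^ 2) * ‖r‖ ^ 2 := by
  -- the step that minimizes the bound is the inverse of the constant in `‖Z r‖² ≤ L ⟨r, Z r⟩`
  refine ⟨(3 / 2 * (1 + κ ^ 2))⁻¹, fun r => ?_⟩
  set L := 3 / 2 * (1 + κ ^ 2) with hL
  have hL0 : 0 < L := by positivity
  have h1 := mulVec_dotProduct_self_le hκ hlow hup hsec r.ofLp
  have h2 := hlow r.ofLp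
  rw [← hL] at h1
  have e : (r - L⁻¹ • toEuclideanLin Z r).ofLp = r.ofLp - L⁻¹ • (Z *ᵥ r.ofLp) := rfl
  rw [norm_sq_eq_dotProduct, norm_sq_eq_dotProduct, e]
  simp only [dotProduct_sub, sub_dotProduct, dotProduct_smul, smul_dotProduct, smul_eq_mul]
  rw [dotProduct_comm (Z *ᵥ r.ofLp) r.ofLp]
  have e2 : (2 + 3 * κ ^ 2) / (3 + 3 * κ ^ 2) = 1 - L⁻¹ * (1 / 2) := by
    rw [hL]; field_simp; ring
  have h3 : L⁻¹ * (L⁻¹ * ((Z *ᵥ r.ofLp) ⬝ᵥ Z *ᵥ r.ofLp)) ≤ L⁻¹ * (r.ofLp ⬝ᵥ Z *ᵥ r.ofLp) := by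
    refine mul_le_mul_of_nonneg_left ?_ (inv_pos.2 hL0).le
    rw [inv_mul_le_iff₀ hL0]
    exact h1
  have h4 := mul_le_mul_of_nonneg_left h2 (inv_pos.2 hL0).le
  rw [e2]
  linarith

theorem krylov_le_succ (Z : Matrix ι ι ℝ) (r : EuclideanSpace ℝ ι) (j : ℕ) :
    krylov Z r j ≤ krylov Z r (j + 1) := by
  refine Submodule.span_mono ?_
  rintro _ ⟨l, rfl⟩
  exact ⟨l.castSucc, rfl⟩

theorem toEuclideanLin_mem_krylov_succ (Z : Matrix ι ι ℝ) (r : EuclideanSpace ℝ ι) (j : ℕ)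
    {x : EuclideanSpace ℝ ι} (hx : x ∈ krylov Z r j) :
    toEuclideanLin Z x ∈ krylov Z r (j + 1) := by
  have h : krylov Z r j ≤ (krylov Z r (j + 1)).comap (toEuclideanLin Z) := by
    refine Submodule.span_le.2 ?_
    rintro _ ⟨l, rfl⟩
    refine Submodule.subset_span ⟨l.succ, ?_⟩
    simp only [Fin.val_succ, pow_succ', toLpLin_apply, mulVec_mulVec]
  exact h hx

theorem self_mem_krylov_succ (Z : Matrix ι ι ℝ) (r : EuclideanSpace ℝ ι) (j : ℕ) :
    r ∈ krylov Z r (j + 1) := by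
  refine Submodule.subset_span ⟨0, ?_⟩
  simp

/-- One step of GMRES is at least as good as one step of a Richardson iteration. -/
theorem norm_residual_succ_le {Z : Matrix ι ι ℝ} {ω α : ℝ}
    (hα : ∀ r : EuclideanSpace ℝ ι, ‖r - α • toEuclideanLin Z r‖ ≤ ω * ‖r‖)
    {w v₀ v v' : EuclideanSpace ℝ ι} {j : ℕ} (hv : IsGMRESIterate Z w v₀ j v)
    (hv' : IsGMRESIterate Z w v₀ (j + 1) v') :
    ‖residual Z w v'‖ ≤ ω * ‖residual Z w v‖ := by
  have hres : residual Z w v = residual Z w v₀ - toEuclideanLin Z (v - v₀) := by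
    simp only [residual, map_sub]
    abel
  have hmem : v + α • residual Z w v - v₀ ∈ krylov Z (residual Z w v₀) (j + 1) := by
    have e : v + α • residual Z w v - v₀ = (v - v₀) + α • residual Z w v := by abel
    rw [e]
    refine Submodule.add_mem _ (krylov_le_succ _ _ _ hv.1) (Submodule.smul_mem _ _ ?_)
    rw [hres]
    exact Submodule.sub_mem _ (self_mem_krylov_succ _ _ _)
      (toEuclideanLin_mem_krylov_succ _ _ _ hv.1)
  have e : residual Z w (v + α • residual Z w v)
      = residual Z w v - α • toEuclideanLin Z (residual Z w v) := by
    rw [residual, map_add, map_smul]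
    simp only [residual]
    abel
  refine (hv'.2 _ hmem).trans ?_
  rw [e]
  exact hα _

theorem IsFullGMRES.norm_residual_le {Z : Matrix ι ι ℝ} {ω α : ℝ} (hω : 0 ≤ ω)
    (hα : ∀ r : EuclideanSpace ℝ ι, ‖r - α • toEuclideanLin Z r‖ ≤ ω * ‖r‖)
    {w : EuclideanSpace ℝ ι} {v : ℕ → EuclideanSpace ℝ ι} (hv : IsFullGMRES Z w v) (k : ℕ) :
    ‖residual Z w (v k)‖ ≤ ω ^ k * ‖residual Z w (v 0)‖ := by
  induction k with
  | zero => simp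
  | succ k ih =>
    calc ‖residual Z w (v (k + 1))‖ ≤ ω * ‖residual Z w (v k)‖ :=
          norm_residual_succ_le hα (hv k) (hv (k + 1))
      _ ≤ ω * (ω ^ k * ‖residual Z w (v 0)‖) := mul_le_mul_of_nonneg_left ih hω
      _ = ω ^ (k + 1) * ‖residual Z w (v 0)‖ := by ring

theorem IsRestartedGMRES.norm_residual_le {Z : Matrix ι ι ℝ} {ω α : ℝ} (hω : 0 ≤ ω)
    (hα : ∀ r : EuclideanSpace ℝ ι, ‖r - α • toEuclideanLin Z r‖ ≤ ω * ‖r‖)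
    {w : EuclideanSpace ℝ ι} {v : ℕ → EuclideanSpace ℝ ι} {m : ℕ} (hm : 0 < m)
    (hv : IsRestartedGMRES m Z w v) (k : ℕ) :
    ‖residual Z w (v k)‖ ≤ ω ^ k * ‖residual Z w (v 0)‖ := by
  induction k with
  | zero => simp
  | succ k ih =>
    -- both iterates belong to the cycle `k / m`, as its inner iterates `k % m` and `k % m + 1`
    have hlt := Nat.mod_lt k hm
    have hk : k / m * m + k % m = k := Nat.div_add_mod' k m
    have h1 := hv (k / m) (k % m) hlt.le
    have h2 := hv (k / m) (k % m + 1) hlt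
    rw [← add_assoc, hk] at h2
    rw [hk] at h1
    calc ‖residual Z w (v (k + 1))‖ ≤ ω * ‖residual Z w (v k)‖ :=
          norm_residual_succ_le hα h1 h2
      _ ≤ ω * (ω ^ k * ‖residual Z w (v 0)‖) := mul_le_mul_of_nonneg_left ih hω
      _ = ω ^ (k + 1) * ‖residual Z w (v 0)‖ := by ring

end GMRESConvergence

/-! ### The convergence rate and the discretized equation -/

theorem omegaRate_mem (δ kp km : Fin 3 → ℝ) :
    omegaRate δ kp km ∈ Set.Ico (Real.sqrt (2 / 3)) 1 := by
  have hs : 0 ≤ varsig δ kp km ^ 2 := sq_nonneg _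
  constructor
  · refine Real.sqrt_le_sqrt ?_
    rw [div_le_div_iff₀ (by norm_num) (by linarith)]
    linarith
  · rw [omegaRate, Real.sqrt_lt' one_pos, one_pow, div_lt_one (by linarith)]
    linarith

theorem eta_pos {n : Fin 3 → ℕ} {a b : Fin 3 → ℝ} {T : ℝ} {M : ℕ} {δ : Fin 3 → ℝ}
    (hab : ∀ i, a i < b i) (hT : 0 < T) (hM : 0 < M) (hδ : ∀ i, 0 < δ i) (i : Fin 3) :
    0 < eta n a b T M δ i := by
  have h1 : 0 < Real.Gamma (δ i + 1) := Real.Gamma_pos_of_pos (by linarith [hδ i])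
  have h2 : 0 < b i - a i := sub_pos.2 (hab i)
  have h3 : (0 : ℝ) < M := by exact_mod_cast hM
  rw [eta]
  positivity

theorem posSemidef_of_equiv {ι : Type*} {A P : Matrix ι ι ℝ}
    (h1 : (A - (1 / 2 : ℝ) • P).PosSemidef) (h2 : ((3 / 2 : ℝ) • P - A).PosSemidef) :
    P.PosSemidef := by
  have h := h1.add h2
  have e : A - (1 / 2 : ℝ) • P + ((3 / 2 : ℝ) • P - A) = P := by module
  rwa [e] at h

theorem posDef_precond (n : Fin 3 → ℕ)
    {a b : Fin 3 → ℝ} (hab : ∀ i, a i < b i) {T : ℝ} (hT : 0 < T) {M : ℕ} (hM : 0 < M)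
    {δ : Fin 3 → ℝ} (hδ : ∀ i, 0 < δ i ∧ δ i < 1)
    {kp km : Fin 3 → ℝ} (hkp : ∀ i, 0 < kp i) (hkm : ∀ i, 0 < km i) :
    (precond n a b T M δ kp km).PosDef := by
  have hη : ∀ i, 0 ≤ eta n a b T M δ i := fun i => (eta_pos hab hT hM (fun i => (hδ i).1) i).le
  have hk : ∀ i, 0 < kp i + km i := fun i => add_pos (hkp i) (hkm i)
  have hequiv := fun i => tauMatrix_stiffB_equiv (hδ i).1 (hδ i).2 (hk i).le (n i)
  exact posDef_threeLevel hη fun i => posSemidef_of_equiv (hequiv i).1 (hequiv i).2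

/-- A Richardson iteration for the preconditioned system contracts with the rate `ω`. Here
`κ = 2 ς / 3` bounds the sectors of the stiffness matrices. -/
theorem exists_norm_sub_smul_twoSided_le (n : Fin 3 → ℕ)
    {a b : Fin 3 → ℝ} (hab : ∀ i, a i < b i) {T : ℝ} (hT : 0 < T) {M : ℕ} (hM : 0 < M)
    {δ : Fin 3 → ℝ} (hδ : ∀ i, 0 < δ i ∧ δ i < 1)
    {kp km : Fin 3 → ℝ} (hkp : ∀ i, 0 < kp i) (hkm : ∀ i, 0 < km i) :
    ∃ α : ℝ, ∀ r : EuclideanSpace ℝ (Grid n),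
      ‖r - α • toEuclideanLin (twoSided n a b T M δ kp km) r‖ ≤ omegaRate δ kp km * ‖r‖ := by
  have hη : ∀ i, 0 ≤ eta n a b T M δ i := fun i => (eta_pos hab hT hM (fun i => (hδ i).1) i).le
  have hk : ∀ i, 0 < kp i + km i := fun i => add_pos (hkp i) (hkm i)
  have hequiv := fun i => tauMatrix_stiffB_equiv (hδ i).1 (hδ i).2 (hk i).le (n i)
  have hP := posDef_precond n hab hT hM hδ hkp hkm
  set P := precond n a b T M δ kp km
  set A := coeffMatrix n a b T M δ kp km
  set G := invSqrt P with hG_def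
  set Z := twoSided n a b T M δ kp km
  have hG : G.transpose = G := invSqrt_transpose P
  have hZ : ∀ x y : Grid n → ℝ, x ⬝ᵥ Z *ᵥ y = (G *ᵥ x) ⬝ᵥ A *ᵥ (G *ᵥ y) :=
    dotProduct_conj_mulVec hG A
  have hone : ∀ x : Grid n → ℝ, x ⬝ᵥ x = (G *ᵥ x) ⬝ᵥ P *ᵥ (G *ᵥ x) := by
    intro x
    rw [← dotProduct_conj_mulVec hG P, hG_def, invSqrt_mul_mul_invSqrt hP, one_mulVec]
  have hsym : symPart A = threeLevel n (eta n a b T M δ)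
      fun i => symPart (stiffB (δ i) (kp i) (km i) (n i)) := symPart_threeLevel
  have hform : ∀ x : Grid n → ℝ, x ⬝ᵥ symPart A *ᵥ x = x ⬝ᵥ A *ᵥ x := by
    intro x
    rw [dotProduct_symPart_mulVec]
    ring
  have hlow : ∀ x : Grid n → ℝ, 1 / 2 * (x ⬝ᵥ x) ≤ x ⬝ᵥ Z *ᵥ x := by
    intro x
    have h := posSemidef_threeLevel_sub (n := n) (c := 1) (d := 1 / 2)
      (B := fun i => symPart (stiffB (δ i) (kp i) (km i) (n i)))
      (C := fun i => tauMatrix (symPart (stiffB (δ i) (kp i) (km i) (n i)))) hη (by norm_num)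
      fun i => by rw [one_smul]; exact (hequiv i).1
    rw [← hsym, one_smul] at h
    have h1 := h.dotProduct_mulVec_nonneg (G *ᵥ x)
    rw [star_trivial, sub_mulVec, dotProduct_sub, hform, smul_mulVec, dotProduct_smul,
      smul_eq_mul] at h1
    rw [hZ, hone]
    exact sub_nonneg.1 h1
  have hup : ∀ x : Grid n → ℝ, x ⬝ᵥ Z *ᵥ x ≤ 3 / 2 * (x ⬝ᵥ x) := by
    intro x
    have h := posSemidef_threeLevel_sub (n := n) (c := 3 / 2) (d := 1)
      (B := fun i => tauMatrix (symPart (stiffB (δ i) (kp i) (km i) (n i))))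
      (C := fun i => symPart (stiffB (δ i) (kp i) (km i) (n i))) hη (by norm_num)
      fun i => by rw [one_smul]; exact (hequiv i).2
    rw [← hsym, one_smul] at h
    have h1 := h.dotProduct_mulVec_nonneg (G *ᵥ x)
    rw [star_trivial, sub_mulVec, dotProduct_sub, hform, smul_mulVec, dotProduct_smul,
      smul_eq_mul] at h1
    rw [hZ, hone]
    exact sub_nonneg.1 h1
  set κ := Finset.univ.sup' Finset.univ_nonempty fun i : Fin 3 =>
    Real.tan (δ i / 2 * Real.pi) * (|kp i - km i| / (kp i + km i))
  have hle : ∀ i, Real.tan (δ i / 2 * Real.pi) * (|kp i - km i| / (kp i + km i)) ≤ κ := fun i =>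
    Finset.le_sup' (fun i : Fin 3 =>
      Real.tan (δ i / 2 * Real.pi) * (|kp i - km i| / (kp i + km i))) (Finset.mem_univ i)
  have hκ : 0 ≤ κ := by
    obtain ⟨hs, hc, ht⟩ := sinInt_pos_and_cosInt_pos_and_tan (hδ 0).1 (hδ 0).2
    refine le_trans ?_ (hle 0)
    rw [ht]
    have := hk 0
    positivity
  have hsec : ∀ x y : Grid n → ℝ,
      x ⬝ᵥ Z *ᵥ y - y ⬝ᵥ Z *ᵥ x ≤ κ * (x ⬝ᵥ Z *ᵥ x + y ⬝ᵥ Z *ᵥ y) := by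
    intro x y
    simp only [hZ]
    exact threeLevel_sector hκ hη
      (fun i => stiffB_sector (hδ i).1 (hδ i).2 (hk i) (hle i)) _ _
  obtain ⟨α, hα⟩ := exists_norm_sub_smul_le hκ hlow hup hsec
  have hω0 : 0 ≤ omegaRate δ kp km := Real.sqrt_nonneg _
  have hvs : varsig δ kp km = 3 / 2 * κ := rfl
  have hω : (2 + 3 * κ ^ 2) / (3 + 3 * κ ^ 2) ≤ omegaRate δ kp km ^ 2 := by
    have hκ2 : 0 ≤ κ ^ 2 := sq_nonneg κ
    rw [omegaRate, Real.sq_sqrt (by positivity), hvs,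
      div_le_div_iff₀ (by positivity) (by positivity)]
    nlinarith
  refine ⟨α, fun r => abs_le_of_sq_le_sq' ?_ (by positivity) |>.2⟩
  rw [mul_pow]
  exact (hα r).trans (mul_le_mul_of_nonneg_right hω (sq_nonneg _))

end Convergence

end FracFV

end

theorem theorem3p2
    (n : Fin 3 → ℕ) (hn : ∀ i, 0 < n i)
    (a b : Fin 3 → ℝ) (hab : ∀ i, a i < b i)
    (T : ℝ) (hT : 0 < T) (M : ℕ) (hM : 0 < M)
    (δ : Fin 3 → ℝ) (hδ : ∀ i, 0 < δ i ∧ δ i < 1)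
    (kp km : Fin 3 → ℝ) (hkp : ∀ i, 0 < kp i) (hkm : ∀ i, 0 < km i) :
    (FracFV.precond n a b T M δ kp km).PosDef ∧
    FracFV.omegaRate δ kp km ∈ Set.Ico (Real.sqrt (2 / 3)) 1 ∧
    ∀ (f w : EuclideanSpace ℝ (FracFV.Grid n)) (v : ℕ → EuclideanSpace ℝ (FracFV.Grid n)),
      w = Matrix.toEuclideanLin (FracFV.invSqrt (FracFV.precond n a b T M δ kp km)) f →
      (FracFV.IsFullGMRES (FracFV.twoSided n a b T M δ kp km) w v ∨
        ∃ m : ℕ, 0 < m ∧ FracFV.IsRestartedGMRES m (FracFV.twoSided n a b T M δ kp km) w v) →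
      ∀ k : ℕ,
        ‖FracFV.residual (FracFV.twoSided n a b T M δ kp km) w (v k)‖
          ≤ FracFV.omegaRate δ kp km ^ k
            * ‖FracFV.residual (FracFV.twoSided n a b T M δ kp km) w (v 0)‖ := by
  obtain ⟨α, hα⟩ := FracFV.exists_norm_sub_smul_twoSided_le n hab hT hM hδ hkp hkm
  have hω : 0 ≤ FracFV.omegaRate δ kp km := Real.sqrt_nonneg _
  refine ⟨FracFV.posDef_precond n hab hT hM hδ hkp hkm, FracFV.omegaRate_mem δ kp km, ?_⟩
  rintro f w v - (hv | ⟨m, hm, hv⟩) k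
  · exact hv.norm_residual_le hω hα k
  · exact hv.norm_residual_le hω hα hm k
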